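/- Let $P_Z$ be a probability distribution on $\mathcal Z$, let $N\ge 1$, and consider the randomized subsample setting: $\tilde S=(\tilde Z_1,\dots,\tilde Z_{2N})$ consists of $2N$ i.i.d. samples from $P_Z$, $U=(U_1,\dots,U_N)$ of $N$ i.i.d. Bernoulli$(1/2)$ bits, and the dataset is $S=(Z_1,\dots,Z_N)$ with $Z_i=\tilde Z_{i+U_iN}$. Let $\{W_\theta:\theta\in\mathbb R^d\}\subseteq\mathcal W$ be a parametrized family of hypotheses and let $\ell:\mathcal W\times\mathcal Z\to[a,b]$ be a loss such that, for every $z$, the function $\theta\mapsto\ell(W_\theta,z)$ is differentiable and $L$-Lipschitz for the Euclidean norm. Write $\operatorname{gen}(w,S)=\mathbb E_{Z\sim P_Z}[\ell(w,Z)]-\frac1N\sum_{i=1}^N\ell(w,Z_i)$. Stochastic gradient Langevin dynamics (SGLD) starts from a random parameter $\theta_0$ and, for $t=1,\dots,T$, sets $$\theta_t=\theta_{t-1}-\eta_t\nabla_\theta\Big(\frac1{|V_t|}\sum_{i\in V_t}\ell(W_{\theta},Z_i)\Big)\Big|_{\theta=\theta_{t-1}}+\sigma_t\varepsilon_t,$$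 where $\eta_t\in\mathbb R$ and $\sigma_t>0$ are deterministic, the $\varepsilon_t\sim\mathcal N(0,I_d)$ are i.i.d., and $V^T=(V_1,\dots,V_T)$ is a random sequence of batches $V_t\subseteq\{1,\dots,N\}$ with an arbitrary law. Assume that $|V_t|=K$ almost surely for every $t$, for a constant $K\ge1$. Let $J$ be uniformly distributed on $\{1,\dots,N\}$, and let $J$, $\tilde S$, $U$, $V^T$, $\theta_0$, $(\varepsilon_t)_{t\le T}$ be mutually independent. Let $W_t=W_{\theta_t}$ and $W=W_T$; a hypothesis is identified with its parameter, so $W^{t-1}$ stands for $(\theta_0,\dots,\theta_{t-1})$. For every $t$, let $\pi_{J,t}\in[0,1]$ be any estimate of the probability that $U_J=1$ that is a measurable function of $J$, $\tilde S$, $U_{J^c}=(U_i)_{i\ne J}$, the batches $V^T$ and the trajectory $W^{t-1}$. Then $$\mathbb E\big[\operatorname{gen}(W,S)\big]\le\frac{2L}{K}(b-a)\,\mathbb E_{P_1}\left[\sqrt{\sum_{t\in\mathcal T_J(V^T)}\mathbb E_{P_2^t}\left[\frac{\eta_t^2}{\sigma_t^2}(U_J-\pi_{J,t})^2\right]}\right],$$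 where $\mathcal T_J(V^T)=\{t: J\in V_t\}$, $P_1$ is the joint law of $(J,\tilde S,U,V^T)$, and $P_2^t$ is the conditional law of $W^{t-1}$ given $(U,\tilde S,V^{t-1})$, with $V^{t-1}=(V_1,\dots,V_{t-1})$. -/

import Mathlib

open MeasureTheory ProbabilityTheory

noncomputable section

/-- The parameter space `ℝ^d` with its Euclidean norm. -/
abbrev Param (d : ℕ) : Type := EuclideanSpace ℝ (Fin d)

/-- A super-sample of `2N` points. The index `(u, i)` stands for the position `i + u N`. -/
abbrev SuperSample (N : ℕ) (𝒵 : Type*) : Type _ := Fin 2 × Fin N → 𝒵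

/-- The dataset selected from the super-sample by the bits `u`: `Z_i = Z̃_{i + u_i N}`. -/
def dataset {N : ℕ} {𝒵 : Type*} (s : SuperSample N 𝒵) (u : Fin N → Fin 2) : Fin N → 𝒵 :=
  fun i => s (u i, i)

/-- The empirical risk of the hypothesis `w` on the points of the dataset `z` indexed by `B`. -/
def empiricalRisk {N : ℕ} {𝒲 𝒵 : Type*} (ℓ : 𝒲 → 𝒵 → ℝ) (z : Fin N → 𝒵)
    (B : Finset (Fin N)) (w : 𝒲) : ℝ :=
  (1 / (B.card : ℝ)) * ∑ i ∈ B, ℓ w (z i)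

/-- The population risk of the hypothesis `w`. -/
def populationRisk {𝒲 𝒵 : Type*} [MeasurableSpace 𝒵] (ℓ : 𝒲 → 𝒵 → ℝ) (PZ : Measure 𝒵)
    (w : 𝒲) : ℝ :=
  ∫ z, ℓ w z ∂PZ

/-- The generalization error of the hypothesis `w` for the dataset `z`: population risk minus
empirical risk on the whole dataset. -/
def genError {N : ℕ} {𝒲 𝒵 : Type*} [MeasurableSpace 𝒵] (ℓ : 𝒲 → 𝒵 → ℝ) (PZ : Measure 𝒵)
    (w : 𝒲) (z : Fin N → 𝒵) : ℝ :=
  populationRisk ℓ PZ w - empiricalRisk ℓ z Finset.univ w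

/-- One iteration of stochastic gradient Langevin dynamics from the parameter `θ`, with batch `B` of
the dataset `z`, learning rate `η`, noise level `σ` and noise `ε`, for the hypotheses `hyp θ`. -/
def sgldStep {N d : ℕ} {𝒲 𝒵 : Type*} (ℓ : 𝒲 → 𝒵 → ℝ) (hyp : Param d → 𝒲) (z : Fin N → 𝒵)
    (B : Finset (Fin N)) (η σ : ℝ) (θ ε : Param d) : Param d :=
  θ - η • gradient (fun θ' => empiricalRisk ℓ z B (hyp θ')) θ + σ • ε

/-- The set of iterations whose batch contains the index `j`. -/
def itersWith {N T : ℕ} (v : Fin T → Finset (Fin N)) (j : Fin N) : Finset (Fin T) :=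
  Finset.univ.filter fun t => j ∈ v t

/-- The bits `u` at all positions other than `j`. -/
def bitsExcept {N : ℕ} (u : Fin N → Fin 2) (j : Fin N) : {i : Fin N // i ≠ j} → Fin 2 :=
  fun i => u i

/-- The parameters available before the update number `t` (counting from `0`): `θ 0, …, θ t`. -/
def paramsUpTo {T : ℕ} {E : Type*} (θ : Fin (T + 1) → E) (t : Fin T) : Fin (t.val + 1) → E :=
  fun s => θ ⟨s.val, lt_of_lt_of_le s.isLt (Nat.succ_le_succ t.isLt.le)⟩

/-- The batches used before the update number `t` (counting from `0`). -/
def batchesBefore {T : ℕ} {B : Type*} (v : Fin T → B) (t : Fin T) : Fin t.val → B :=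
  fun s => v ⟨s.val, s.isLt.trans t.isLt⟩

/-- The regular conditional distribution of the trajectory of parameters before the update number
`t`, given the bits, the super-sample and the batches used before that update. -/
def trajectoryLaw {Ω 𝒵 : Type*} [MeasurableSpace Ω] [MeasurableSpace 𝒵] {N d T : ℕ}
    (μ : Measure Ω) [IsFiniteMeasure μ] (S : Ω → SuperSample N 𝒵) (U : Ω → Fin N → Fin 2)
    (V : Ω → Fin T → Finset (Fin N)) (θ : Fin (T + 1) → Ω → Param d) (t : Fin T) :
    Kernel ((Fin N → Fin 2) × SuperSample N 𝒵 × (Fin t.val → Finset (Fin N)))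
      (Fin (t.val + 1) → Param d) :=
  condDistrib (fun ω => paramsUpTo (fun s => θ s ω) t)
    (fun ω => (U ω, S ω, batchesBefore (V ω) t)) μ

end

noncomputable section

/-! The unselected point of each pair is independent of the trained parameter, so its loss has the
same mean as the population risk. Hence the expected generalization error is the average over `j` of
the expected gap between the loss at the unselected and at the selected point of pair `j`
(`integral_genError_eq`).

Fix `j`, the super-sample, the other bits and the batches. With `f` the difference of the losses at
the two points of the pair, the gap is `f` when the bit is 0 and `-f` when it is 1. The sum over the
two bits is therefore the difference of the means of `f` under two training runs. Both are compared
with one reference run, whose drift mixes the two gradients with weights `1 - π` and `π`; it does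
not depend on the bit at `j`, so its mean cancels (`rootError_sub_lossGap_nonneg`).

The comparison is a Girsanov-type argument. A true run with noise `e` is the reference run with
noise `e + a`, where the shift `a` at each time depends on earlier noise only. For a Gaussian,
shifting by `a` costs relative entropy at most `‖a‖ ^ 2 / 2`; `EntropicShift` is the dual
(Donsker–Varadhan) form of this, and `EntropicShift.predictable` is the chain rule. With Hoeffding's
lemma and optimization over the scale, this gives a Pinsker inequality
(`EntropicShift.integral_shift_sub_le`) with cost averaged along the true run.

The two datasets differ at `j` only, so the gradients differ by at most `2 * L / K`, and only when
the batch contains `j` (`norm_gradient_empiricalRisk_sub_le`). This yields the prefactor and the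
restricted sum (`integral_history_sub_le`). Finally, independence of the noise identifies the
conditional trajectory law with the law of the recursion under fresh noise (`trajectoryLaw_ae_eq`).
-/

theorem integrable_of_abs_le {α : Type*} [MeasurableSpace α] {μ : Measure α} [IsFiniteMeasure μ]
    {f : α → ℝ} (hf : Measurable f) {C : ℝ} (hC : ∀ x, |f x| ≤ C) : Integrable f μ :=
  Integrable.of_bound hf.aestronglyMeasurable C (Filter.Eventually.of_forall hC)

theorem abs_integral_le_of_abs_le {α : Type*} [MeasurableSpace α] {μ : Measure α}
    [IsProbabilityMeasure μ] {f : α → ℝ} {C : ℝ} (hC : ∀ x, |f x| ≤ C) :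
    |∫ x, f x ∂μ| ≤ C := by
  simpa using norm_integral_le_of_norm_le_const (μ := μ) (f := f) (Filter.Eventually.of_forall hC)

/-! ### Entropy cost of shifting Gaussian noise, and a Pinsker inequality -/

/-- The entropic shift inequality with cost `q`: translating the argument of `Ψ` by `a` costs at
most `q a / 2` in the comparison of the mean with the logarithmic moment generating function. -/
def EntropicShift {E : Type*} [Add E] [MeasurableSpace E] (γ : Measure E) (q : E → ℝ) : Prop :=
  ∀ (a : E) (Ψ : E → ℝ) (C : ℝ), Measurable Ψ → (∀ x, |Ψ x| ≤ C) →
    ∫ x, Ψ (x + a) ∂γ - q a / 2 ≤ Real.log (∫ x, Real.exp (Ψ x) ∂γ)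

/-- Translating Lebesgue measure turns the exponential moment into the mean of `exp (Ψ (x + a) + (-a
* x - a ^ 2 / 2))`, the extra term being the log-ratio of the densities. Jensen for `exp` then
suffices, since that term has mean `-a ^ 2 / 2`. -/
theorem entropicShift_gaussianReal : EntropicShift (gaussianReal 0 1) (fun x => x ^ 2) := by
  intro a Ψ C hΨ hC
  have hchange : ∫ x, Real.exp (Ψ x) ∂(gaussianReal 0 1) =
      ∫ x, Real.exp (Ψ (x + a) + (-a * x - a ^ 2 / 2)) ∂(gaussianReal 0 1) := by
    rw [integral_gaussianReal_eq_integral_smul one_ne_zero,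
      integral_gaussianReal_eq_integral_smul one_ne_zero,
      ← integral_add_right_eq_self _ a]
    congr 1 with x
    simp only [gaussianPDFReal, smul_eq_mul, NNReal.coe_one, mul_one, sub_zero]
    rw [mul_assoc, mul_assoc, ← Real.exp_add, ← Real.exp_add]
    ring_nf
  have hid : Integrable (fun x : ℝ => x) (gaussianReal 0 1) :=
    memLp_one_iff_integrable.1 (memLp_id_gaussianReal' 1 (by simp))
  have hshift : Measurable fun x => Ψ (x + a) := hΨ.comp (measurable_add_const a)
  have hΨi : Integrable (fun x => Ψ (x + a)) (gaussianReal 0 1) :=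
    integrable_of_abs_le hshift fun x => hC _
  have hlin : Integrable (fun x => -a * x - a ^ 2 / 2) (gaussianReal 0 1) :=
    (hid.const_mul _).sub (integrable_const _)
  have hexp : Integrable (fun x => Real.exp (Ψ (x + a) + (-a * x - a ^ 2 / 2)))
      (gaussianReal 0 1) := by
    have h1 : Integrable (fun x => Real.exp (-a * x)) (gaussianReal 0 1) :=
      integrable_exp_mul_gaussianReal _
    have h2 := (h1.mul_const (Real.exp (- a ^ 2 / 2))).bdd_mul (c := Real.exp C)
      (f := fun x => Real.exp (Ψ (x + a))) hshift.exp.aestronglyMeasurable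
      (Filter.Eventually.of_forall fun x => by
        simpa using (abs_le.1 (hC (x + a))).2)
    refine h2.congr (Filter.Eventually.of_forall fun x => ?_)
    simp only [← Real.exp_add]
    ring_nf
  have hjensen := convexOn_exp.map_integral_le (μ := gaussianReal 0 1)
    Real.continuous_exp.continuousOn isClosed_univ (Filter.Eventually.of_forall fun x => trivial)
    (hΨi.add hlin) (by simpa [Function.comp_def] using hexp)
  have hmean : ∫ x, (Ψ (x + a) + (-a * x - a ^ 2 / 2)) ∂(gaussianReal 0 1) =
      ∫ x, Ψ (x + a) ∂(gaussianReal 0 1) - a ^ 2 / 2 := by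
    rw [integral_add hΨi hlin, integral_sub (hid.const_mul _) (integrable_const _),
      integral_const_mul, integral_id_gaussianReal]
    simp
    ring
  simp only [Pi.add_apply] at hjensen
  rw [hmean, ← hchange] at hjensen
  exact (Real.le_log_iff_exp_le (lt_of_lt_of_le (Real.exp_pos _) hjensen)).2 hjensen

theorem integral_pi_cons {E : Type*} [MeasurableSpace E] {γ : Measure E} [IsProbabilityMeasure γ]
    {n : ℕ} {F : (Fin (n + 1) → E) → ℝ} (hF : Measurable F) {C : ℝ} (hC : ∀ x, |F x| ≤ C) :
    ∫ x, F x ∂(Measure.pi fun _ => γ) =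
      ∫ x, ∫ y, F (Fin.cons x y) ∂(Measure.pi fun _ => γ) ∂γ := by
  have hmp := (measurePreserving_piFinSuccAbove (fun _ : Fin (n + 1) => γ) 0).symm
  rw [← hmp.integral_comp', integral_prod]
  · simp [MeasurableEquiv.piFinSuccAbove_symm_apply, Fin.insertNthEquiv]
  · exact integrable_of_abs_le (hF.comp (MeasurableEquiv.measurable _)) fun x => hC _

theorem measurable_finCons {E : Type*} [MeasurableSpace E] {n : ℕ} :
    Measurable fun p : E × (Fin n → E) => (Fin.cons p.1 p.2 : Fin (n + 1) → E) := by
  refine measurable_pi_lambda _ fun i => ?_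
  refine Fin.cases ?_ (fun j => ?_) i
  · simpa using measurable_fst
  · simp only [Fin.cons_succ]
    fun_prop

/-- Bounded test functions stay bounded, with the same constant, when coordinates are integrated out
through log-exp. This keeps the induction on the number of coordinates within the class allowed by
`EntropicShift`. -/
theorem abs_log_integral_exp_le {α : Type*} [MeasurableSpace α] {μ : Measure α}
    [IsProbabilityMeasure μ] {f : α → ℝ} (hf : Measurable f) {C : ℝ} (hC : ∀ x, |f x| ≤ C) :
    0 < ∫ x, Real.exp (f x) ∂μ ∧ |Real.log (∫ x, Real.exp (f x) ∂μ)| ≤ C := by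
  have hint : Integrable (fun x => Real.exp (f x)) μ :=
    integrable_of_abs_le hf.exp (C := Real.exp C) fun x => by
      simpa using (abs_le.1 (hC x)).2
  have hlow : Real.exp (-C) ≤ ∫ x, Real.exp (f x) ∂μ := by
    simpa using integral_mono (integrable_const (Real.exp (-C))) hint
      fun x => Real.exp_le_exp.2 (abs_le.1 (hC x)).1
  have hupp : ∫ x, Real.exp (f x) ∂μ ≤ Real.exp C := by
    simpa using integral_mono hint (integrable_const (Real.exp C))
      fun x => Real.exp_le_exp.2 (abs_le.1 (hC x)).2
  have hpos := (Real.exp_pos _).trans_le hlow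
  exact ⟨hpos, abs_le.2 ⟨(Real.le_log_iff_exp_le hpos).2 hlow, (Real.log_le_iff_le_exp hpos).2 hupp⟩⟩

/-- The entropic shift inequality for a product measure and a predictable shift. -/
theorem EntropicShift.predictable {E : Type*} [Add E] [MeasurableSpace E] [MeasurableAdd₂ E]
    {γ : Measure E} [IsProbabilityMeasure γ] {q : E → ℝ} (hγ : EntropicShift γ q)
    (hq : Measurable q) {n : ℕ} (a : Fin n → (Fin n → E) → E) (ha : ∀ t, Measurable (a t))
    (hpred : ∀ t x y, (∀ s, s < t → x s = y s) → a t x = a t y)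
    {D : ℝ} (hD : ∀ t x, |q (a t x)| ≤ D)
    {G : (Fin n → E) → ℝ} (hG : Measurable G) {C : ℝ} (hC : ∀ x, |G x| ≤ C) :
    ∫ x, (G (fun t => x t + a t x) - (∑ t, q (a t x)) / 2) ∂(Measure.pi fun _ => γ) ≤
      Real.log (∫ x, Real.exp (G x) ∂(Measure.pi fun _ => γ)) := by
  induction n with
  | zero =>
    have hx (x : Fin 0 → E) : G x = G (fun i => i.elim0) := congrArg G (Subsingleton.elim _ _)
    simp [hx]
  | succ n ih =>
    obtain ⟨x₀⟩ : Nonempty E := by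
      by_contra h
      rw [not_nonempty_iff] at h
      have := measure_univ (μ := γ)
      simp [Measure.eq_zero_of_isEmpty γ] at this
    -- No coordinate precedes the first one, so predictability makes the first shift a constant.
    set a₀ : E := a 0 fun _ => x₀
    have ha₀ (x) : a 0 x = a₀ := hpred 0 _ _ fun s hs => absurd hs (Fin.not_lt_zero s)
    -- Chain rule: given the first coordinate, the induction hypothesis bounds the tail by this
    -- log-moment, and the one-coordinate inequality is then applied to `Ψ`.
    let Ψ : E → ℝ := fun x => Real.log (∫ y, Real.exp (G (Fin.cons x y)) ∂(Measure.pi fun _ => γ))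
    have hGc (x : E) : Measurable fun y : Fin n → E => G (Fin.cons x y) :=
      hG.comp (measurable_finCons.comp measurable_prodMk_left)
    have hΨpos (x : E) := (abs_log_integral_exp_le (μ := Measure.pi fun _ => γ) (hGc x)
      fun y => hC _).1
    have hΨC (x : E) : |Ψ x| ≤ C := (abs_log_integral_exp_le (hGc x) fun y => hC _).2
    have hΨ : Measurable Ψ := by
      refine Real.measurable_log.comp ?_
      exact ((hG.comp measurable_finCons).exp.stronglyMeasurable.integral_prod_right).measurable
    have hF : Measurable fun x : Fin (n + 1) → E =>
        G (fun t => x t + a t x) - (∑ t, q (a t x)) / 2 := by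
      refine Measurable.sub (hG.comp ?_) (Measurable.div_const ?_ _)
      · exact measurable_pi_lambda _ fun t => (measurable_pi_apply t).add (ha t)
      · exact Finset.measurable_sum _ fun t _ => hq.comp (ha t)
    have hFb (x : Fin (n + 1) → E) :
        |G (fun t => x t + a t x) - (∑ t, q (a t x)) / 2| ≤ C + ((n + 1 : ℕ) * D) / 2 := by
      have h1 : |∑ t, q (a t x)| ≤ (n + 1 : ℕ) * D := by
        refine (Finset.abs_sum_le_sum_abs _ _).trans ?_
        simpa using Finset.sum_le_sum fun t (_ : t ∈ Finset.univ) => hD t x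
      have h2 := abs_sub (G fun t => x t + a t x) ((∑ t, q (a t x)) / 2)
      rw [abs_div, abs_two] at h2
      linarith [hC fun t => x t + a t x]
    have hexp : ∫ x, Real.exp (G x) ∂(Measure.pi fun _ => γ) = ∫ x, Real.exp (Ψ x) ∂γ := by
      rw [integral_pi_cons hG.exp (C := Real.exp C)]
      · exact integral_congr_ae (Filter.Eventually.of_forall fun x =>
          (Real.exp_log (hΨpos x)).symm)
      · intro x
        simpa using (abs_le.1 (hC x)).2
    have hinner (x : E) :
        ∫ y, (G (fun t => (Fin.cons x y : Fin (n + 1) → E) t + a t (Fin.cons x y)) -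
          (∑ t, q (a t (Fin.cons x y))) / 2) ∂(Measure.pi fun _ => γ) ≤
        Ψ (x + a₀) - q a₀ / 2 := by
      have hm (t : Fin n) : Measurable fun y : Fin n → E => a t.succ (Fin.cons x y) :=
        (ha _).comp (measurable_finCons.comp measurable_prodMk_left)
      have := ih (fun t y => a t.succ (Fin.cons x y)) hm
        (fun t y z hyz => hpred _ _ _ fun s hs => by
          induction s using Fin.cases with
          | zero => rfl
          | succ s => simpa using hyz s (Fin.succ_lt_succ_iff.1 hs))
        (fun t y => hD _ _) (hGc (x + a₀)) fun y => hC _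
      have hcons (y : Fin n → E) :
          (fun t => (Fin.cons x y : Fin (n + 1) → E) t + a t (Fin.cons x y)) =
            Fin.cons (x + a₀) fun t => y t + a t.succ (Fin.cons x y) := by
        funext t
        induction t using Fin.cases with
        | zero => simp [ha₀]
        | succ t => simp
      simp_rw [hcons, Fin.sum_univ_succ, ha₀]
      have hsplit (y : Fin n → E) :
          G (Fin.cons (x + a₀) fun t => y t + a t.succ (Fin.cons x y)) -
            (q a₀ + ∑ t : Fin n, q (a t.succ (Fin.cons x y))) / 2 =
          (G (Fin.cons (x + a₀) fun t => y t + a t.succ (Fin.cons x y)) -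
            (∑ t : Fin n, q (a t.succ (Fin.cons x y))) / 2) - q a₀ / 2 := by ring
      simp_rw [hsplit]
      rw [integral_sub _ (integrable_const _)]
      · simpa using this
      · refine integrable_of_abs_le (C := C + ((n : ℕ) * D) / 2) ?_ fun y => ?_
        · refine Measurable.sub ((hGc (x + a₀)).comp ?_) (Measurable.div_const ?_ _)
          · exact measurable_pi_lambda _ fun t => (measurable_pi_apply t).add (hm t)
          · exact Finset.measurable_sum _ fun t _ => hq.comp (hm t)
        · have h1 : |∑ t : Fin n, q (a t.succ (Fin.cons x y))| ≤ (n : ℕ) * D := by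
            refine (Finset.abs_sum_le_sum_abs _ _).trans ?_
            simpa using Finset.sum_le_sum fun t (_ : t ∈ Finset.univ) =>
              hD (Fin.succ t) (Fin.cons x y)
          have h2 := abs_sub (G (Fin.cons (x + a₀) fun t => y t + a t.succ (Fin.cons x y)))
            ((∑ t : Fin n, q (a t.succ (Fin.cons x y))) / 2)
          rw [abs_div, abs_two] at h2
          linarith [hC (Fin.cons (x + a₀) fun t => y t + a t.succ (Fin.cons x y))]
    rw [integral_pi_cons hF hFb, hexp]
    refine le_trans ?_ (hγ a₀ Ψ C hΨ hΨC)
    have hΨi : Integrable (fun x => Ψ (x + a₀)) γ :=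
      integrable_of_abs_le (hΨ.comp (measurable_add_const a₀)) fun x => hΨC _
    calc _ ≤ ∫ x, (Ψ (x + a₀) - q a₀ / 2) ∂γ := by
          refine integral_mono ?_ (hΨi.sub (integrable_const _)) hinner
          refine integrable_of_abs_le ?_ fun x => abs_integral_le_of_abs_le fun y => hFb _
          exact ((hF.comp measurable_finCons).stronglyMeasurable.integral_prod_right').measurable
      _ = _ := by rw [integral_sub hΨi (integrable_const _)]; simp

/-- The standard Gaussian is a product of real ones, so the product inequality applies with constant
shifts, and the coordinate costs add up to the squared norm. -/
theorem entropicShift_stdGaussian (d : ℕ) :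
    EntropicShift (stdGaussian (Param d)) (fun x => ‖x‖ ^ 2) := by
  intro a Ψ C hΨ hC
  have hm : Measurable (WithLp.toLp 2 : (Fin d → ℝ) → Param d) := WithLp.measurable_toLp 2 _
  rw [← map_pi_eq_stdGaussian, integral_map hm.aemeasurable hΨ.exp.aestronglyMeasurable,
    integral_map (f := fun x => Ψ (x + a)) hm.aemeasurable
      (hΨ.comp (measurable_add_const a)).aestronglyMeasurable]
  have := entropicShift_gaussianReal.predictable (by fun_prop) (fun (i : Fin d) _ => a i)
    (fun _ => measurable_const) (fun _ _ _ _ => rfl) (D := ∑ i, a i ^ 2)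
    (fun i _ => by
      rw [abs_of_nonneg (sq_nonneg _)]
      exact Finset.single_le_sum (f := fun i => a i ^ 2) (fun i _ => sq_nonneg _)
        (Finset.mem_univ i))
    (hΨ.comp hm) fun x => hC _
  refine le_trans (le_of_eq ?_) this
  rw [integral_sub _ (integrable_const _)]
  · simp only [integral_const, probReal_univ, one_smul, EuclideanSpace.real_norm_sq_eq]
    rfl
  · refine integrable_of_abs_le ?_ fun x => hC _
    exact hΨ.comp (hm.comp (by fun_prop))

/-- Hoeffding's lemma on `[-M, M]`, an interval of length `2 * M`, which gives the variance proxy `M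
^ 2`. -/
theorem log_integral_exp_mul_le {α : Type*} [MeasurableSpace α] {μ : Measure α}
    [IsProbabilityMeasure μ] {f : α → ℝ} (hf : Measurable f) {M : ℝ} (hM : ∀ x, |f x| ≤ M)
    (r : ℝ) :
    Real.log (∫ x, Real.exp (r * f x) ∂μ) ≤ r * ∫ x, f x ∂μ + r ^ 2 * M ^ 2 / 2 := by
  have hsub := (hasSubgaussianMGF_of_mem_Icc (μ := μ) (a := -M) (b := M) hf.aemeasurable
    (Filter.Eventually.of_forall fun x => abs_le.1 (hM x))).mgf_le r
  have hc : (((‖M - -M‖₊ / 2) ^ 2 : NNReal) : ℝ) = M ^ 2 := by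
    simp only [NNReal.coe_pow, NNReal.coe_div, coe_nnnorm, Real.norm_eq_abs, NNReal.coe_ofNat,
      div_pow, sq_abs]
    ring
  rw [hc] at hsub
  have hmgf : mgf (fun x => f x - ∫ y, f y ∂μ) μ r =
      (∫ x, Real.exp (r * f x) ∂μ) * Real.exp (-(r * ∫ y, f y ∂μ)) := by
    rw [mgf, ← integral_mul_const]
    congr 1 with x
    rw [← Real.exp_add]
    ring_nf
  rw [hmgf] at hsub
  have hpos := (abs_log_integral_exp_le (μ := μ) (f := fun x => r * f x) (hf.const_mul r)
    (C := |r| * M) fun x => by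
      rw [abs_mul]; exact mul_le_mul_of_nonneg_left (hM x) (abs_nonneg r)).1
  rw [Real.log_le_iff_le_exp hpos]
  have := mul_le_mul_of_nonneg_right hsub (Real.exp_pos (r * ∫ y, f y ∂μ)).le
  rw [mul_assoc, ← Real.exp_add, ← Real.exp_add] at this
  simp only [neg_add_cancel, Real.exp_zero, mul_one] at this
  refine this.trans (Real.exp_le_exp.2 (le_of_eq ?_))
  ring

theorem le_mul_sqrt_of_forall_mul_le {X A M : ℝ} (hM : 0 < M) (hA : 0 ≤ A)
    (h : ∀ r, 0 < r → r * X ≤ A / 2 + r ^ 2 * M ^ 2 / 2) : X ≤ M * Real.sqrt A := by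
  refine le_of_forall_pos_le_add fun e he => ?_
  have hs := Real.sqrt_nonneg A
  have hsq := Real.sq_sqrt hA
  set s := Real.sqrt A
  have hw : 0 < M * s + e := by positivity
  -- The optimal scale is `s / M`; adding `e` keeps it positive when `A = 0`.
  have := h ((M * s + e) / M ^ 2) (by positivity)
  have h2 : (M * s + e) * X ≤ (A * M ^ 2) / 2 + (M * s + e) ^ 2 / 2 := by
    have := mul_le_mul_of_nonneg_right this (sq_nonneg M)
    field_simp at this
    linarith
  have h3 : A * M ^ 2 ≤ (M * s + e) ^ 2 := by
    rw [← hsq]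
    nlinarith [mul_nonneg hM.le hs]
  nlinarith

/-- A Pinsker-type inequality: a predictable shift of the noise changes the mean of a function
bounded by `M` by at most `M` times the root of the mean total cost of the shift. -/
theorem EntropicShift.integral_shift_sub_le {E E₀ : Type*} [Add E] [MeasurableSpace E]
    [MeasurableAdd₂ E] [MeasurableSpace E₀] {γ : Measure E} [IsProbabilityMeasure γ]
    {q : E → ℝ} (hγ : EntropicShift γ q) (hq : Measurable q) (hq0 : ∀ x, 0 ≤ q x)
    (ν : Measure E₀) [IsProbabilityMeasure ν] {n : ℕ} (a : Fin n → E₀ × (Fin n → E) → E)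
    (ha : ∀ t, Measurable (a t))
    (hpred : ∀ t w x y, (∀ s, s < t → x s = y s) → a t (w, x) = a t (w, y))
    {D : ℝ} (hD : ∀ t p, q (a t p) ≤ D)
    {G : E₀ × (Fin n → E) → ℝ} (hG : Measurable G) {M : ℝ} (hM : ∀ p, |G p| ≤ M) :
    ∫ p, G (p.1, fun t => p.2 t + a t p) ∂(ν.prod (Measure.pi fun _ => γ)) -
        ∫ p, G p ∂(ν.prod (Measure.pi fun _ => γ)) ≤
      M * Real.sqrt (∫ p, ∑ t, q (a t p) ∂(ν.prod (Measure.pi fun _ => γ))) := by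
  set P := ν.prod (Measure.pi fun _ : Fin n => γ)
  have hDabs (t p) : |q (a t p)| ≤ D := by rw [abs_of_nonneg (hq0 _)]; exact hD t p
  have hGa : Measurable fun p : E₀ × (Fin n → E) => G (p.1, fun t => p.2 t + a t p) :=
    hG.comp (measurable_fst.prodMk (measurable_pi_lambda _ fun t =>
      ((measurable_pi_apply t).comp measurable_snd).add (ha t)))
  have hQ : Measurable fun p => ∑ t, q (a t p) :=
    Finset.measurable_sum _ fun t _ => hq.comp (ha t)
  have hQb (p) : |∑ t, q (a t p)| ≤ n * D := by
    refine (Finset.abs_sum_le_sum_abs _ _).trans ?_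
    simpa using Finset.sum_le_sum fun t (_ : t ∈ Finset.univ) => hDabs t p
  have hGi : Integrable G P := integrable_of_abs_le hG hM
  have hGai : Integrable (fun p => G (p.1, fun t => p.2 t + a t p)) P :=
    integrable_of_abs_le hGa fun p => hM _
  have hQi : Integrable (fun p => ∑ t, q (a t p)) P := integrable_of_abs_le hQ hQb
  have hA : 0 ≤ ∫ p, ∑ t, q (a t p) ∂P :=
    integral_nonneg fun p => Finset.sum_nonneg fun t _ => hq0 _
  obtain ⟨p₀⟩ : Nonempty (E₀ × (Fin n → E)) := by
    by_contra h
    rw [not_nonempty_iff] at h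
    have := measure_univ (μ := P)
    simp [Measure.eq_zero_of_isEmpty P] at this
  -- Optimizing the scale divides by `M`; if `M = 0`, then `G` vanishes.
  rcases ((abs_nonneg _).trans (hM p₀)).eq_or_lt with h0 | hpos
  · have hz (p) : G p = 0 := abs_nonpos_iff.1 (h0 ▸ hM p)
    simp [hz, ← h0]
  refine le_mul_sqrt_of_forall_mul_le hpos hA fun r hr => ?_
  -- For fixed `r` the inequality is linear in the means, so it is averaged over the initial state
  -- first and optimized in `r` afterwards. The average over the initial state thus ends up inside
  -- the root.
  have hfib (w : E₀) :
      ∫ x, (r * G (w, fun t => x t + a t (w, x)) - (∑ t, q (a t (w, x))) / 2)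
          ∂(Measure.pi fun _ => γ) ≤
        ∫ x, r * G (w, x) ∂(Measure.pi fun _ => γ) + r ^ 2 * M ^ 2 / 2 := by
    have h1 := hγ.predictable hq (fun t x => a t (w, x))
      (fun t => (ha t).comp measurable_prodMk_left) (fun t => hpred t w)
      (fun t x => hDabs t (w, x)) (G := fun x => r * G (w, x))
      ((hG.comp measurable_prodMk_left).const_mul r) (C := r * M) fun x => by
        rw [abs_mul, abs_of_pos hr]
        exact mul_le_mul_of_nonneg_left (hM _) hr.le
    have h2 := log_integral_exp_mul_le (μ := Measure.pi fun _ : Fin n => γ)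
      (f := fun x => G (w, x)) (hG.comp measurable_prodMk_left) (fun x => hM _) r
    rw [integral_const_mul]
    exact h1.trans h2
  have hL : Integrable (fun p : E₀ × (Fin n → E) =>
      r * G (p.1, fun t => p.2 t + a t p) - (∑ t, q (a t p)) / 2) P :=
    (hGai.const_mul r).sub (hQi.div_const 2)
  have hR : Integrable (fun p => r * G p) P := hGi.const_mul r
  have hint : ∫ p, (r * G (p.1, fun t => p.2 t + a t p) - (∑ t, q (a t p)) / 2) ∂P ≤
      ∫ p, r * G p ∂P + r ^ 2 * M ^ 2 / 2 := by
    rw [integral_prod _ hL, integral_prod _ hR]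
    have := integral_mono hL.integral_prod_left
      (hR.integral_prod_left.add (integrable_const (r ^ 2 * M ^ 2 / 2))) hfib
    refine this.trans (le_of_eq ?_)
    simp only [Pi.add_apply]
    rw [integral_add hR.integral_prod_left (integrable_const _)]
    simp
  rw [integral_sub (hGai.const_mul r) (hQi.div_const 2), integral_const_mul, integral_const_mul,
    integral_div] at hint
  linarith

/-! ### Noise-driven recursions as deterministic functions of start and noise -/

/-- The histories of the recursion `θ (t + 1) = Φ t (θ 0, …, θ t) (e t)` started at `w`. -/
def history {E : Type*} {T : ℕ} (Φ : (t : Fin T) → (Fin (t.val + 1) → E) → E → E)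
    (w : E) (e : Fin T → E) : (n : ℕ) → Fin (n + 1) → E
  | 0 => fun _ => w
  | n + 1 => Fin.snoc (history Φ w e n)
      (if h : n < T then Φ ⟨n, h⟩ (history Φ w e n) (e ⟨n, h⟩) else w)

theorem eq_history {E : Type*} {T : ℕ} {Φ : (t : Fin T) → (Fin (t.val + 1) → E) → E → E}
    {w : E} {e : Fin T → E} {p : Fin (T + 1) → E} (h0 : p 0 = w)
    (hp : ∀ t : Fin T, p t.succ = Φ t (paramsUpTo p t) (e t)) (n : ℕ) (hn : n ≤ T) :
    (fun s : Fin (n + 1) => p ⟨s.val, lt_of_lt_of_le s.isLt (Nat.succ_le_succ hn)⟩) =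
      history Φ w e n := by
  induction n with
  | zero =>
    funext s
    obtain rfl : s = 0 := Fin.fin_one_eq_zero s
    exact h0
  | succ n ih =>
    have ih' := ih (Nat.le_of_succ_le hn)
    have hlt : n < T := hn
    have hup : paramsUpTo p ⟨n, hlt⟩ = history Φ w e n := ih'
    funext s
    rw [history]
    refine Fin.lastCases ?_ (fun i => ?_) s
    · rw [Fin.snoc_last, dif_pos hlt, ← hup, ← hp]
      rfl
    · rw [Fin.snoc_castSucc, ← ih']
      rfl

/-- The updates need to agree only along the history of the first recursion and before time `n`.
This serves the coupling with the reference run, the predictability of the shift, and the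
independence from later batches. -/
theorem history_congr {E : Type*} {T : ℕ} {Φ Φ' : (t : Fin T) → (Fin (t.val + 1) → E) → E → E}
    {w : E} {e e' : Fin T → E} {n : ℕ}
    (h : ∀ t : Fin T, t.val < n → Φ t (history Φ w e t.val) (e t) =
      Φ' t (history Φ w e t.val) (e' t)) :
    history Φ w e n = history Φ' w e' n := by
  induction n with
  | zero => rfl
  | succ n ih =>
    have ih' := ih fun t ht => h t (ht.trans (Nat.lt_succ_self n))
    rw [history, history, ← ih']
    by_cases hlt : n < T
    · rw [dif_pos hlt, dif_pos hlt, h ⟨n, hlt⟩ (Nat.lt_succ_self n)]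
    · rw [dif_neg hlt, dif_neg hlt]

theorem measurable_finSnoc {E : Type*} [MeasurableSpace E] {n : ℕ} :
    Measurable fun p : (Fin n → E) × E => (Fin.snoc p.1 p.2 : Fin (n + 1) → E) := by
  refine measurable_pi_lambda _ fun i => ?_
  refine Fin.lastCases ?_ (fun j => ?_) i
  · simpa using measurable_snd
  · simp only [Fin.snoc_castSucc]
    fun_prop

theorem measurable_history {A E : Type*} [MeasurableSpace A] [MeasurableSpace E] {T : ℕ}
    {Φ : A → (t : Fin T) → (Fin (t.val + 1) → E) → E → E}
    (hΦ : ∀ t, Measurable fun p : A × (Fin (t.val + 1) → E) × E => Φ p.1 t p.2.1 p.2.2)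
    {w : A → E} (hw : Measurable w) {e : A → Fin T → E} (he : Measurable e) (n : ℕ) :
    Measurable fun x => history (Φ x) (w x) (e x) n := by
  induction n with
  | zero => exact measurable_pi_lambda _ fun _ => hw
  | succ n ih =>
    by_cases hlt : n < T
    · have hs : (fun x => history (Φ x) (w x) (e x) (n + 1)) = fun x =>
          Fin.snoc (history (Φ x) (w x) (e x) n)
            (Φ x ⟨n, hlt⟩ (history (Φ x) (w x) (e x) n) (e x ⟨n, hlt⟩)) := by
        funext x
        rw [history, dif_pos hlt]
      rw [hs]
      exact measurable_finSnoc.comp (ih.prodMk ((hΦ ⟨n, hlt⟩).comp (measurable_id.prodMk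
        (ih.prodMk ((measurable_pi_apply (⟨n, hlt⟩ : Fin T)).comp he)))))
    · have hs : (fun x => history (Φ x) (w x) (e x) (n + 1)) = fun x =>
          Fin.snoc (history (Φ x) (w x) (e x) n) (w x) := by
        funext x
        rw [history, dif_neg hlt]
      rw [hs]
      exact measurable_finSnoc.comp (ih.prodMk hw)

/-! ### Measurability and size of gradients -/

/-- Each partial derivative is a pointwise limit of difference quotients with step `1 / (n + 1)`,
which are jointly measurable; no continuity of the gradient is needed. -/
theorem measurable_gradient {A : Type*} [MeasurableSpace A] {d : ℕ} {F : A × Param d → ℝ}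
    (hF : Measurable F) (hd : ∀ z, Differentiable ℝ fun x => F (z, x)) :
    Measurable fun p : A × Param d => gradient (fun x => F (p.1, x)) p.2 := by
  have hcoord (i : Fin d) :
      Measurable fun p : A × Param d => (gradient (fun x => F (p.1, x)) p.2) i := by
    let e : Param d := EuclideanSpace.single i 1
    let c : ℕ → ℝ := fun n => (n : ℝ) + 1
    refine measurable_of_tendsto_metrizable
      (f := fun n (p : A × Param d) => c n * (F (p.1, p.2 + (c n)⁻¹ • e) - F p)) (fun n => ?_) ?_
    · refine Measurable.const_mul (Measurable.sub (hF.comp ?_) hF) _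
      exact measurable_fst.prodMk (measurable_snd.add_const _)
    · rw [tendsto_pi_nhds]
      intro p
      have hfd := ((hd p.1) p.2).hasFDerivAt
      have hlim := HasFDerivAt.lim (𝕜 := ℝ) (l := Filter.atTop) (c := c) hfd e
        (by
          simp only [c]
          have : Filter.Tendsto (fun n : ℕ => (n : ℝ) + 1) Filter.atTop Filter.atTop :=
            Filter.tendsto_atTop_add_const_right _ _ tendsto_natCast_atTop_atTop
          exact Filter.tendsto_abs_atTop_atTop.comp this)
      have hval : (gradient (fun x => F (p.1, x)) p.2) i =
          fderiv ℝ (fun x => F (p.1, x)) p.2 e := by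
        rw [← InnerProductSpace.toDual_symm_apply (𝕜 := ℝ) (E := Param d), ← gradient,
          EuclideanSpace.inner_single_right]
        simp
      rw [hval]
      simpa [smul_eq_mul] using hlim
  have : (fun p : A × Param d => gradient (fun x => F (p.1, x)) p.2) =
      fun p => WithLp.toLp 2 fun i => (gradient (fun x => F (p.1, x)) p.2) i := by
    funext p
    rfl
  rw [this]
  exact (WithLp.measurable_toLp 2 _).comp (measurable_pi_lambda _ hcoord)

theorem norm_gradient_le_of_lipschitz {d : ℕ} {f : Param d → ℝ} {L : NNReal}
    (hf : LipschitzWith L f) (x : Param d) : ‖gradient f x‖ ≤ L := by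
  rw [gradient, LinearIsometryEquiv.norm_map]
  exact norm_fderiv_le_of_lipschitz ℝ hf

/-! ### Comparison of a true run with the reference run -/

section SGLD

variable {𝒲 𝒵 : Type*} {N d T : ℕ}

/-- The update of stochastic gradient Langevin dynamics as a function of the history. -/
def sgldUpdate (ℓ : 𝒲 → 𝒵 → ℝ) (hyp : Param d → 𝒲) (η σ : Fin T → ℝ) (z : Fin N → 𝒵)
    (v : Fin T → Finset (Fin N)) (t : Fin T) (h : Fin (t.val + 1) → Param d) (e : Param d) :
    Param d :=
  sgldStep ℓ hyp z (v t) (η t) (σ t) (h (Fin.last t.val)) e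

/-- The update whose drift averages the gradients of the two datasets `z 0` and `z 1` with the
weights given by the estimate `π`. -/
def mixedUpdate (ℓ : 𝒲 → 𝒵 → ℝ) (hyp : Param d → 𝒲) (η σ : Fin T → ℝ) (z : Fin 2 → Fin N → 𝒵)
    (v : Fin T → Finset (Fin N)) (π : (t : Fin T) → (Fin (t.val + 1) → Param d) → ℝ) (t : Fin T)
    (h : Fin (t.val + 1) → Param d) (e : Param d) : Param d :=
  h (Fin.last t.val) - η t •
    ((1 - π t h) • gradient (fun x => empiricalRisk ℓ (z 0) (v t) (hyp x)) (h (Fin.last t.val)) +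
      π t h • gradient (fun x => empiricalRisk ℓ (z 1) (v t) (hyp x)) (h (Fin.last t.val))) +
    σ t • e

theorem differentiable_empiricalRisk {ℓ : 𝒲 → 𝒵 → ℝ} {hyp : Param d → 𝒲}
    (hd : ∀ z, Differentiable ℝ fun x : Param d => ℓ (hyp x) z) (z : Fin N → 𝒵)
    (B : Finset (Fin N)) : Differentiable ℝ fun x => empiricalRisk ℓ z B (hyp x) := by
  unfold empiricalRisk
  exact (Differentiable.fun_sum fun i _ => hd (z i)).const_mul _

theorem gradient_empiricalRisk {ℓ : 𝒲 → 𝒵 → ℝ} {hyp : Param d → 𝒲}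
    (hd : ∀ z, Differentiable ℝ fun x : Param d => ℓ (hyp x) z) (z : Fin N → 𝒵)
    (B : Finset (Fin N)) (x : Param d) :
    gradient (fun x => empiricalRisk ℓ z B (hyp x)) x =
      (1 / (B.card : ℝ)) • ∑ i ∈ B, gradient (fun x => ℓ (hyp x) (z i)) x := by
  unfold empiricalRisk gradient
  rw [fderiv_const_mul (DifferentiableAt.fun_sum fun i _ => hd (z i) x),
    fderiv_fun_sum fun i _ => hd (z i) x]
  simp [map_sum]

/-- All terms cancel except the one at `j`, where each of the two gradients has norm at most `L`. -/
theorem norm_gradient_empiricalRisk_sub_le {ℓ : 𝒲 → 𝒵 → ℝ} {hyp : Param d → 𝒲}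
    (hd : ∀ z, Differentiable ℝ fun x : Param d => ℓ (hyp x) z) {L : NNReal}
    (hL : ∀ z, LipschitzWith L fun x : Param d => ℓ (hyp x) z) {z z' : Fin N → 𝒵} {j : Fin N}
    (hz : ∀ i, i ≠ j → z i = z' i) (B : Finset (Fin N)) (x : Param d) :
    ‖gradient (fun x => empiricalRisk ℓ z B (hyp x)) x -
        gradient (fun x => empiricalRisk ℓ z' B (hyp x)) x‖ ≤
      if j ∈ B then 2 * (L : ℝ) / B.card else 0 := by
  rw [gradient_empiricalRisk hd, gradient_empiricalRisk hd, ← smul_sub, ← Finset.sum_sub_distrib]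
  split_ifs with hj
  · rw [Finset.sum_eq_single_of_mem j hj fun i _ hi => by rw [hz i hi, sub_self], norm_smul]
    have h := (norm_sub_le (gradient (fun x => ℓ (hyp x) (z j)) x)
      (gradient (fun x => ℓ (hyp x) (z' j)) x)).trans
      (add_le_add (norm_gradient_le_of_lipschitz (hL _) x)
        (norm_gradient_le_of_lipschitz (hL _) x))
    rw [Real.norm_of_nonneg (by positivity)]
    refine (mul_le_mul_of_nonneg_left h (by positivity)).trans (le_of_eq ?_)
    ring
  · rw [Finset.sum_eq_zero fun i hi => by
      rw [hz i fun h => hj (h ▸ hi), sub_self]]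
    simp

variable [MeasurableSpace 𝒵]

theorem measurable_gradient_empiricalRisk {α : Type*} [MeasurableSpace α] {ℓ : 𝒲 → 𝒵 → ℝ}
    {hyp : Param d → 𝒲} (hm : Measurable fun p : Param d × 𝒵 => ℓ (hyp p.1) p.2)
    (hd : ∀ z, Differentiable ℝ fun x : Param d => ℓ (hyp x) z) (B : Finset (Fin N))
    {z : α → Fin N → 𝒵} {x : α → Param d} (hz : Measurable z) (hx : Measurable x) :
    Measurable fun a => gradient (fun x => empiricalRisk ℓ (z a) B (hyp x)) (x a) := by
  have hF : Measurable fun p : (Fin N → 𝒵) × Param d => empiricalRisk ℓ p.1 B (hyp p.2) := by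
    unfold empiricalRisk
    refine Measurable.const_mul (Finset.measurable_sum _ fun i _ => ?_) _
    exact hm.comp (measurable_snd.prodMk ((measurable_pi_apply i).comp measurable_fst))
  have h := (measurable_gradient hF fun z => differentiable_empiricalRisk hd z B).comp
    (hz.prodMk hx)
  exact h

theorem measurable_sgldUpdate {α : Type*} [MeasurableSpace α] {ℓ : 𝒲 → 𝒵 → ℝ} {hyp : Param d → 𝒲}
    (hm : Measurable fun p : Param d × 𝒵 => ℓ (hyp p.1) p.2)
    (hd : ∀ z, Differentiable ℝ fun x : Param d => ℓ (hyp x) z) (η σ : Fin T → ℝ)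
    {z : α → Fin N → 𝒵} (hz : Measurable z) (v : Fin T → Finset (Fin N)) (t : Fin T) :
    Measurable fun p : α × (Fin (t.val + 1) → Param d) × Param d =>
      sgldUpdate ℓ hyp η σ (z p.1) v t p.2.1 p.2.2 := by
  have hlast : Measurable fun p : α × (Fin (t.val + 1) → Param d) × Param d =>
      p.2.1 (Fin.last t.val) := (measurable_pi_apply _).comp measurable_snd.fst
  have hg : Measurable fun p : α × (Fin (t.val + 1) → Param d) × Param d =>
      gradient (fun x => empiricalRisk ℓ (z p.1) (v t) (hyp x)) (p.2.1 (Fin.last t.val)) :=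
    measurable_gradient_empiricalRisk hm hd (v t) (hz.comp measurable_fst) hlast
  unfold sgldUpdate sgldStep
  fun_prop

/-- Measurability of the trajectory in the dataset, the initialization and the noise. -/
theorem measurable_history_sgldUpdate {α : Type*} [MeasurableSpace α] {ℓ : 𝒲 → 𝒵 → ℝ}
    {hyp : Param d → 𝒲} (hm : Measurable fun p : Param d × 𝒵 => ℓ (hyp p.1) p.2)
    (hd : ∀ z, Differentiable ℝ fun x : Param d => ℓ (hyp x) z) (η σ : Fin T → ℝ)
    {z : α → Fin N → 𝒵} (hz : Measurable z) (v : Fin T → Finset (Fin N))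
    {w : α → Param d} (hw : Measurable w) {e : α → Fin T → Param d} (he : Measurable e) (n : ℕ) :
    Measurable fun x => history (sgldUpdate ℓ hyp η σ (z x) v) (w x) (e x) n :=
  measurable_history (Φ := fun x => sgldUpdate ℓ hyp η σ (z x) v)
    (fun t => measurable_sgldUpdate hm hd η σ hz v t) hw he n

theorem measurable_mixedUpdate {ℓ : 𝒲 → 𝒵 → ℝ} {hyp : Param d → 𝒲}
    (hm : Measurable fun p : Param d × 𝒵 => ℓ (hyp p.1) p.2)
    (hd : ∀ z, Differentiable ℝ fun x : Param d => ℓ (hyp x) z) (η σ : Fin T → ℝ)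
    (z : Fin 2 → Fin N → 𝒵) (v : Fin T → Finset (Fin N))
    {π : (t : Fin T) → (Fin (t.val + 1) → Param d) → ℝ} (hπ : ∀ t, Measurable (π t)) (t : Fin T) :
    Measurable fun p : (Fin (t.val + 1) → Param d) × Param d =>
      mixedUpdate ℓ hyp η σ z v π t p.1 p.2 := by
  have hlast : Measurable fun p : (Fin (t.val + 1) → Param d) × Param d =>
      p.1 (Fin.last t.val) := (measurable_pi_apply _).comp measurable_fst
  have hg (c : Fin 2) : Measurable fun p : (Fin (t.val + 1) → Param d) × Param d =>
      gradient (fun x => empiricalRisk ℓ (z c) (v t) (hyp x)) (p.1 (Fin.last t.val)) :=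
    measurable_gradient_empiricalRisk hm hd (v t) measurable_const hlast
  have hw : Measurable fun p : (Fin (t.val + 1) → Param d) × Param d => π t p.1 :=
    (hπ t).comp measurable_fst
  unfold mixedUpdate
  fun_prop

/-- The final parameters trained on two datasets that differ at the position `j` only. -/
theorem integral_history_sub_le {ℓ : 𝒲 → 𝒵 → ℝ} {hyp : Param d → 𝒲}
    (hm : Measurable fun p : Param d × 𝒵 => ℓ (hyp p.1) p.2)
    (hd : ∀ z, Differentiable ℝ fun x : Param d => ℓ (hyp x) z) {L : NNReal}
    (hL : ∀ z, LipschitzWith L fun x : Param d => ℓ (hyp x) z) (η : Fin T → ℝ) {σ : Fin T → ℝ}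
    (hσ : ∀ t, 0 < σ t) {z : Fin 2 → Fin N → 𝒵} {j : Fin N} (hz : ∀ i, i ≠ j → z 0 i = z 1 i)
    {v : Fin T → Finset (Fin N)} {K : ℕ} (hv : ∀ t, (v t).card = K)
    {π : (t : Fin T) → (Fin (t.val + 1) → Param d) → ℝ} (hπ : ∀ t, Measurable (π t))
    (hπ01 : ∀ t h, π t h ∈ Set.Icc (0 : ℝ) 1)
    (ν : Measure (Param d)) [IsProbabilityMeasure ν] {f : Param d → ℝ} (hf : Measurable f) {M : ℝ}
    (hM : ∀ x, |f x| ≤ M) (c : Fin 2) :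
    ∫ p, f (history (sgldUpdate ℓ hyp η σ (z c) v) p.1 p.2 T (Fin.last T))
        ∂(ν.prod (Measure.pi fun _ => stdGaussian (Param d))) -
      ∫ p, f (history (mixedUpdate ℓ hyp η σ z v π) p.1 p.2 T (Fin.last T))
        ∂(ν.prod (Measure.pi fun _ => stdGaussian (Param d))) ≤
    2 * (L : ℝ) / K * M * Real.sqrt (∑ t ∈ itersWith v j,
      ∫ p, (η t) ^ 2 / (σ t) ^ 2 *
        ((c.val : ℝ) - π t (history (sgldUpdate ℓ hyp η σ (z c) v) p.1 p.2 t.val)) ^ 2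
        ∂(ν.prod (Measure.pi fun _ => stdGaussian (Param d)))) := by
  set P := ν.prod (Measure.pi fun _ : Fin T => stdGaussian (Param d))
  let H : (n : ℕ) → Param d × (Fin T → Param d) → Fin (n + 1) → Param d := fun n p =>
    history (sgldUpdate ℓ hyp η σ (z c) v) p.1 p.2 n
  have hH (n) : Measurable (H n) :=
    measurable_history_sgldUpdate hm hd η σ measurable_const v measurable_fst measurable_snd n
  let g : (c : Fin 2) → (t : Fin T) → Param d → Param d := fun c t =>
    gradient (fun x => empiricalRisk ℓ (z c) (v t) (hyp x))
  have hg (c t) : Measurable (g c t) :=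
    measurable_gradient_empiricalRisk hm hd (v t) measurable_const measurable_id
  -- `σ t • a t` is `η t` times the mixed drift minus the gradient of dataset `c`. This difference
  -- is `π • (g 1 - g 0)` for `c = 0` and `(π - 1) • (g 1 - g 0)` for `c = 1`.
  let a : Fin T → Param d × (Fin T → Param d) → Param d := fun t p =>
    (η t / σ t) • ((π t (H t p) - c.val) •
      (g 1 t (H t p (Fin.last t.val)) - g 0 t (H t p (Fin.last t.val))))
  have ha (t) : Measurable (a t) := by
    have hl : Measurable fun p => H t p (Fin.last t.val) := (measurable_pi_apply _).comp (hH t)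
    have hw : Measurable fun p => π t (H t p) := (hπ t).comp (hH t)
    have hd (c : Fin 2) : Measurable fun p => g c t (H t p (Fin.last t.val)) := (hg c t).comp hl
    exact ((hw.sub_const (c.val : ℝ)).smul ((hd 1).sub (hd 0))).const_smul (η t / σ t)
  have hbound (t p) : ‖a t p‖ ^ 2 ≤ if j ∈ v t then (2 * (L : ℝ) / K) ^ 2 *
      ((η t) ^ 2 / (σ t) ^ 2 * ((c.val : ℝ) - π t (H t p)) ^ 2) else 0 := by
    have h := norm_gradient_empiricalRisk_sub_le hd hL (z := z 1) (z' := z 0) (j := j)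
      (fun i hi => (hz i hi).symm) (v t) (H t p (Fin.last t.val))
    simp only [a, norm_smul, mul_pow, Real.norm_eq_abs, sq_abs]
    split_ifs at h ⊢ with hj
    · rw [hv t] at h
      have h2 := pow_le_pow_left₀ (norm_nonneg _) h 2
      rw [div_pow, show (π t (H t p) - (c.val : ℝ)) ^ 2 = ((c.val : ℝ) - π t (H t p)) ^ 2 by ring]
      calc _ ≤ η t ^ 2 / σ t ^ 2 * (((c.val : ℝ) - π t (H t p)) ^ 2 * (2 * (L : ℝ) / K) ^ 2) := by
            gcongr
        _ = _ := by ring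
    · have h3 := le_antisymm h (norm_nonneg _)
      change ‖g 1 t (H t p (Fin.last t.val)) - g 0 t (H t p (Fin.last t.val))‖ = 0 at h3
      rw [h3]
      simp
  have hsq (t h) : ((c.val : ℝ) - π t h) ^ 2 ≤ 1 := by
    obtain ⟨h0, h1⟩ := hπ01 t h
    have hc : (c.val : ℝ) = 0 ∨ (c.val : ℝ) = 1 := by fin_cases c <;> simp
    rcases hc with hc | hc <;> rw [hc] <;> nlinarith
  have hD (t p) : ‖a t p‖ ^ 2 ≤
      ∑ t, (2 * (L : ℝ) / K) ^ 2 * ((η t) ^ 2 / (σ t) ^ 2) := by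
    refine (hbound t p).trans (le_trans ?_ (Finset.single_le_sum
      (f := fun t => (2 * (L : ℝ) / K) ^ 2 * ((η t) ^ 2 / (σ t) ^ 2))
      (fun i _ => by positivity) (Finset.mem_univ t)))
    split_ifs
    · exact mul_le_mul_of_nonneg_left (mul_le_of_le_one_right (by positivity) (hsq t _))
        (by positivity)
    · positivity
  let F : (c : Fin T) → Param d × (Fin T → Param d) → ℝ := fun t p =>
    (η t) ^ 2 / (σ t) ^ 2 * ((c.val : ℝ) - π t (H t p)) ^ 2
  have hF (t) : Integrable (F t) P := by
    refine integrable_of_abs_le (C := (η t) ^ 2 / (σ t) ^ 2) ?_ fun p => ?_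
    · exact ((measurable_const.sub ((hπ t).comp (hH t))).pow_const 2).const_mul _
    · rw [abs_of_nonneg (by positivity)]
      exact mul_le_of_le_one_right (by positivity) (hsq t _)
  -- The shift at time `t` sees the true run up to `θ t`, which uses the noise at times `s < t`
  -- only.
  have hpred : ∀ t w x y, (∀ s, s < t → x s = y s) → a t (w, x) = a t (w, y) := by
    intro t w x y hxy
    have : H t (w, x) = H t (w, y) := history_congr fun s hs =>
      congrArg (sgldUpdate ℓ hyp η σ (z c) v s _) (hxy s hs)
    simp only [a, this]
  let G : Param d × (Fin T → Param d) → ℝ := fun p =>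
    f (history (mixedUpdate ℓ hyp η σ z v π) p.1 p.2 T (Fin.last T))
  have hG : Measurable G := by
    have hA : Measurable fun p : Param d × (Fin T → Param d) =>
        history (mixedUpdate ℓ hyp η σ z v π) p.1 p.2 T :=
      measurable_history (Φ := fun _ => mixedUpdate ℓ hyp η σ z v π)
        (fun t => (measurable_mixedUpdate hm hd η σ z v hπ t).comp measurable_snd)
        measurable_fst measurable_snd T
    exact hf.comp ((measurable_pi_apply (Fin.last T)).comp hA)
  have hmain := (entropicShift_stdGaussian d).integral_shift_sub_le (by fun_prop)
    (fun x => by positivity) ν a ha hpred hD hG (M := M) (fun p => hM _)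
  -- Exact coupling: along the true history, the shifted noise turns each reference update into the
  -- true one.
  have hcoup (p : Param d × (Fin T → Param d)) :
      G (p.1, fun t => p.2 t + a t p) = f (H T p (Fin.last T)) := by
    have : H T p = history (mixedUpdate ℓ hyp η σ z v π) p.1 (fun t => p.2 t + a t p) T := by
      refine history_congr fun t _ => ?_
      change H t p (Fin.last t.val) - η t • g c t (H t p (Fin.last t.val)) + σ t • p.2 t =
        H t p (Fin.last t.val) - η t • ((1 - π t (H t p)) • g 0 t (H t p (Fin.last t.val)) +
          π t (H t p) • g 1 t (H t p (Fin.last t.val))) + σ t • (p.2 t + a t p)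
      have hs : σ t • a t p = η t • ((π t (H t p) - c.val) •
          (g 1 t (H t p (Fin.last t.val)) - g 0 t (H t p (Fin.last t.val)))) := by
        simp only [a]
        rw [smul_smul, mul_div_cancel₀ _ (hσ t).ne']
      rw [smul_add (σ t), hs]
      fin_cases c
      · simp only [Fin.zero_eta, Nat.cast_zero, sub_zero]
        module
      · simp only [Fin.mk_one, Nat.cast_one]
        module
    simp only [G, ← this]
  simp only [hcoup] at hmain
  refine hmain.trans ?_
  have hM0 : 0 ≤ M := (abs_nonneg _).trans (hM 0)
  have hK : 0 ≤ 2 * (L : ℝ) / K := by positivity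
  have hcost : ∫ p, ∑ t, ‖a t p‖ ^ 2 ∂P ≤
      (2 * (L : ℝ) / K) ^ 2 * ∑ t ∈ itersWith v j, ∫ p, F t p ∂P := by
    rw [← integral_finsetSum _ fun t _ => hF t, ← integral_const_mul]
    refine integral_mono_of_nonneg (Filter.Eventually.of_forall fun p =>
      Finset.sum_nonneg fun t _ => by positivity)
      ((integrable_finsetSum _ fun t _ => hF t).const_mul _)
      (Filter.Eventually.of_forall fun p => ?_)
    simp only [itersWith, Finset.sum_filter, Finset.mul_sum]
    refine Finset.sum_le_sum fun t _ => (hbound t p).trans (le_of_eq ?_)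
    split_ifs <;> simp [F]
  calc M * Real.sqrt (∫ p, ∑ t, ‖a t p‖ ^ 2 ∂P)
      ≤ M * Real.sqrt ((2 * (L : ℝ) / K) ^ 2 * ∑ t ∈ itersWith v j, ∫ p, F t p ∂P) :=
        mul_le_mul_of_nonneg_left (Real.sqrt_le_sqrt hcost) hM0
    _ = _ := by
        rw [Real.sqrt_mul (sq_nonneg _), Real.sqrt_sq hK]
        ring

end SGLD

/-! ### Resampling one coordinate, uniform bits, conditional laws -/

/-- Bits, batches and indices take finitely many values, so measurability may be checked with them
frozen. -/
theorem Measurable.comp_countable {α γ δ : Type*} [MeasurableSpace α] [MeasurableSpace γ]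
    [MeasurableSpace δ] [Countable γ] [MeasurableSingletonClass γ] {f : α → γ → δ} {c : α → γ}
    (hf : ∀ g, Measurable fun x => f x g) (hc : Measurable c) : Measurable fun x => f x (c x) := by
  have h : Measurable fun p : α × γ => f p.1 p.2 := measurable_from_prod_countable_left hf
  exact h.comp (measurable_id.prodMk hc)

theorem measurePreserving_update {ι : Type*} [Fintype ι] [DecidableEq ι] {X : Type*}
    [MeasurableSpace X] (μ : Measure X) [IsProbabilityMeasure μ] (k : ι) :
    MeasurePreserving (fun p : (ι → X) × X => Function.update p.1 k p.2)
      ((Measure.pi fun _ => μ).prod μ) (Measure.pi fun _ => μ) := by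
  refine ⟨by fun_prop, (Measure.pi_eq fun s hs => ?_).symm⟩
  have hpre : (fun p : (ι → X) × X => Function.update p.1 k p.2) ⁻¹' Set.univ.pi s =
      (Set.univ.pi (Function.update s k Set.univ)) ×ˢ s k := by
    ext p
    simp only [Set.mem_preimage, Set.mem_univ_pi, Set.mem_prod]
    constructor
    · intro h
      refine ⟨fun i => ?_, by simpa using h k⟩
      by_cases hi : i = k
      · subst hi; simp
      · simpa [hi] using h i
    · rintro ⟨h1, h2⟩ i
      by_cases hi : i = k
      · subst hi; simpa using h2
      · simpa [hi] using h1 i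
  rw [Measure.map_apply (by fun_prop) (MeasurableSet.univ_pi hs), hpre, Measure.prod_prod,
    Measure.pi_pi, ← Finset.prod_erase_mul _ _ (Finset.mem_univ k),
    ← Finset.prod_erase_mul _ (fun i => μ (s i)) (Finset.mem_univ k)]
  simp only [Function.update_self, measure_univ, mul_one]
  congr 1
  refine Finset.prod_congr rfl fun i hi => ?_
  rw [Function.update_of_ne (Finset.ne_of_mem_erase hi)]

/-- Resampling one coordinate does not change the mean. -/
theorem integral_pi_update {ι : Type*} [Fintype ι] [DecidableEq ι] {X : Type*}
    [MeasurableSpace X] {μ : Measure X} [IsProbabilityMeasure μ] {g : (ι → X) → ℝ}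
    (hg : Measurable g) {C : ℝ} (hC : ∀ x, |g x| ≤ C) (k : ι) :
    ∫ s, g s ∂(Measure.pi fun _ => μ) =
      ∫ s, ∫ x, g (Function.update s k x) ∂μ ∂(Measure.pi fun _ => μ) := by
  have hmp := measurePreserving_update μ k
  have hint : Integrable (fun p : (ι → X) × X => g (Function.update p.1 k p.2))
      ((Measure.pi fun _ => μ).prod μ) :=
    integrable_of_abs_le (hg.comp hmp.measurable) fun p => hC _
  calc _ = ∫ p : (ι → X) × X, g (Function.update p.1 k p.2) ∂((Measure.pi fun _ => μ).prod μ) := by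
        conv_lhs => rw [← hmp.map_eq]
        exact integral_map hmp.measurable.aemeasurable hg.aestronglyMeasurable
    _ = _ := integral_prod _ hint

theorem integral_uniformOfFintype {α : Type*} [Fintype α] [Nonempty α] [MeasurableSpace α]
    [MeasurableSingletonClass α] (f : α → ℝ) :
    ∫ x, f x ∂(PMF.uniformOfFintype α).toMeasure = (1 / (Fintype.card α : ℝ)) * ∑ x, f x := by
  rw [PMF.integral_eq_sum, Finset.mul_sum]
  refine Finset.sum_congr rfl fun x _ => ?_
  simp

/-- The mean over uniform bits after averaging over the value of one bit. -/
theorem integral_bits_nonneg {N : ℕ} {g : (Fin N → Fin 2) → ℝ} (j : Fin N)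
    (h : ∀ u, 0 ≤ g (Function.update u j 0) + g (Function.update u j 1)) :
    0 ≤ ∫ u, g u ∂(Measure.pi fun _ : Fin N => (PMF.uniformOfFintype (Fin 2)).toMeasure) := by
  rw [integral_pi_update (C := ∑ u, |g u|) (measurable_of_countable g)
    (fun u => Finset.single_le_sum (f := fun u => |g u|) (fun i _ => abs_nonneg _)
      (Finset.mem_univ u)) j]
  refine integral_nonneg fun u => ?_
  rw [integral_uniformOfFintype, Fin.sum_univ_two]
  exact mul_nonneg (by positivity) (h u)

/-- Freezing lemma: since `X'` is independent of `X`, conditioning on `X` just fixes the first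
argument of `F`. The kernel so obtained has the right joint law, and conditional distributions are
almost surely unique. -/
theorem condDistrib_ae_eq_map {Ω A B C : Type*} [MeasurableSpace Ω] [MeasurableSpace A]
    [MeasurableSpace B] [MeasurableSpace C] [StandardBorelSpace C] [Nonempty C]
    {μ : Measure Ω} [IsProbabilityMeasure μ] {ν : Measure B} [IsProbabilityMeasure ν]
    {X : Ω → A} {X' : Ω → B} {Y : Ω → C} (hX : Measurable X) (hX' : Measurable X')
    (hY : Measurable Y) {F : A → B → C} (hF : Measurable fun p : A × B => F p.1 p.2)
    (hlaw : μ.map (fun ω => (X ω, X' ω)) = (μ.map X).prod ν)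
    (hYF : ∀ᵐ ω ∂μ, Y ω = F (X ω) (X' ω)) :
    ∀ᵐ ω ∂μ, condDistrib Y X μ (X ω) = ν.map (F (X ω)) := by
  let κ : Kernel A C := (Kernel.id ×ₖ Kernel.const A ν).map fun p => F p.1 p.2
  have hκ (x : A) : κ x = ν.map (F x) := by
    rw [Kernel.map_apply _ hF, Kernel.prod_apply, Kernel.id_apply, Kernel.const_apply,
      Measure.dirac_prod, Measure.map_map hF measurable_prodMk_left]
    rfl
  have : IsMarkovKernel κ := Kernel.IsMarkovKernel.map _ hF
  have := Measure.isProbabilityMeasure_map (μ := μ) hX.aemeasurable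
  have hFx (x : A) : Measurable (F x) := hF.comp measurable_prodMk_left
  have hcomp : μ.map (fun ω => (X ω, Y ω)) = μ.map X ⊗ₘ κ := by
    have hm : Measurable fun p : A × B => (p.1, F p.1 p.2) := measurable_fst.prodMk hF
    have h1 : μ.map (fun ω => (X ω, Y ω)) =
        (μ.map fun ω => (X ω, X' ω)).map fun p => (p.1, F p.1 p.2) := by
      rw [Measure.map_map hm (hX.prodMk hX')]
      exact Measure.map_congr (hYF.mono fun ω h => by simp [h])
    rw [h1, hlaw]
    ext s hs
    rw [Measure.map_apply hm hs, Measure.prod_apply (hm hs), Measure.compProd_apply hs]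
    refine lintegral_congr fun x => ?_
    rw [hκ, Measure.map_apply (hFx x) (measurable_prodMk_left hs)]
    rfl
  have h := condDistrib_ae_eq_of_measure_eq_compProd_of_measurable hX hY hcomp
  filter_upwards [ae_of_ae_map hX.aemeasurable h] with ω hω
  rw [hω, hκ]

theorem map_comp_prod_eq {Ω A A' B : Type*} [MeasurableSpace Ω] [MeasurableSpace A]
    [MeasurableSpace A'] [MeasurableSpace B] {μ : Measure Ω} {ρ : Measure A} {ν : Measure B}
    [IsProbabilityMeasure ρ] [IsProbabilityMeasure ν] {X : Ω → A} {X' : Ω → B}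
    (hX : Measurable X) (hX' : Measurable X')
    (h : μ.map (fun ω => (X ω, X' ω)) = ρ.prod ν) {g : A → A'} (hg : Measurable g) :
    μ.map (fun ω => (g (X ω), X' ω)) = (μ.map fun ω => g (X ω)).prod ν := by
  have hρ : μ.map X = ρ := by
    have := congrArg (Measure.map Prod.fst) h
    rw [Measure.map_map measurable_fst (hX.prodMk hX')] at this
    simpa [Function.comp_def] using this
  have h1 : μ.map (fun ω => g (X ω)) = ρ.map g := by
    rw [← hρ, Measure.map_map hg hX]
    rfl
  have : IsProbabilityMeasure (ρ.map g) := Measure.isProbabilityMeasure_map hg.aemeasurable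
  have h2 : μ.map (fun ω => (g (X ω), X' ω)) =
      (μ.map fun ω => (X ω, X' ω)).map (Prod.map g id) := by
    rw [Measure.map_map (hg.prodMap measurable_id) (hX.prodMk hX')]
    rfl
  rw [h2, h, h1, ← Measure.map_prod_map _ _ hg measurable_id, Measure.map_id]

/-! ### The bound for one pair, with everything but its bit and the noise fixed -/

section Trajectory

variable {𝒲 𝒵 : Type*} {N d T : ℕ}

/-- The first `n + 1` parameters of the training run on the dataset selected by `u`, driven by the
initialization `x.1` and the noise `x.2`. -/
def trajectory (ℓ : 𝒲 → 𝒵 → ℝ) (hyp : Param d → 𝒲) (η σ : Fin T → ℝ) (s : SuperSample N 𝒵)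
    (u : Fin N → Fin 2) (v : Fin T → Finset (Fin N)) (x : Param d × (Fin T → Param d)) (n : ℕ) :
    Fin (n + 1) → Param d :=
  history (sgldUpdate ℓ hyp η σ (dataset s u) v) x.1 x.2 n

/-- The loss of the trained hypothesis on the unselected point at `j` minus its loss on the
selected one. -/
def lossGap (ℓ : 𝒲 → 𝒵 → ℝ) (hyp : Param d → 𝒲) (η σ : Fin T → ℝ) (j : Fin N)
    (s : SuperSample N 𝒵) (u : Fin N → Fin 2) (v : Fin T → Finset (Fin N))
    (x : Param d × (Fin T → Param d)) : ℝ :=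
  ℓ (hyp (trajectory ℓ hyp η σ s u v x T (Fin.last T))) (s (1 - u j, j)) -
    ℓ (hyp (trajectory ℓ hyp η σ s u v x T (Fin.last T))) (s (u j, j))

/-- The squared error of the estimate of the bit at `j` before the update number `t`, weighted by
the signal-to-noise ratio of that update. -/
def weightedError (ℓ : 𝒲 → 𝒵 → ℝ) (hyp : Param d → 𝒲) (η σ : Fin T → ℝ)
    (est : (j : Fin N) → (t : Fin T) → SuperSample N 𝒵 × ({i : Fin N // i ≠ j} → Fin 2) ×
      (Fin T → Finset (Fin N)) × (Fin (t.val + 1) → Param d) → ℝ) (j : Fin N) (t : Fin T)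
    (s : SuperSample N 𝒵) (u : Fin N → Fin 2) (v : Fin T → Finset (Fin N))
    (x : Param d × (Fin T → Param d)) : ℝ :=
  (η t) ^ 2 / (σ t) ^ 2 * (((u j).val : ℝ) -
    est j t (s, bitsExcept u j, v, trajectory ℓ hyp η σ s u v x t.val)) ^ 2

/-- The root of the total mean weighted error of the estimates of the bit at `j`. -/
def rootError (ℓ : 𝒲 → 𝒵 → ℝ) (hyp : Param d → 𝒲) (η σ : Fin T → ℝ)
    (est : (j : Fin N) → (t : Fin T) → SuperSample N 𝒵 × ({i : Fin N // i ≠ j} → Fin 2) ×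
      (Fin T → Finset (Fin N)) × (Fin (t.val + 1) → Param d) → ℝ)
    (ν : Measure (Param d × (Fin T → Param d))) (j : Fin N)
    (s : SuperSample N 𝒵) (u : Fin N → Fin 2) (v : Fin T → Finset (Fin N)) : ℝ :=
  Real.sqrt (∑ t ∈ itersWith v j, ∫ x, weightedError ℓ hyp η σ est j t s u v x ∂ν)

variable {ℓ : 𝒲 → 𝒵 → ℝ} {hyp : Param d → 𝒲}

theorem abs_lossGap_le {a b : ℝ} (hb : ∀ w z, ℓ w z ∈ Set.Icc a b) (η σ : Fin T → ℝ) (j : Fin N)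
    (s : SuperSample N 𝒵) (u : Fin N → Fin 2) (v : Fin T → Finset (Fin N))
    (x : Param d × (Fin T → Param d)) : |lossGap ℓ hyp η σ j s u v x| ≤ b - a := by
  have h1 := hb (hyp (trajectory ℓ hyp η σ s u v x T (Fin.last T))) (s (1 - u j, j))
  have h2 := hb (hyp (trajectory ℓ hyp η σ s u v x T (Fin.last T))) (s (u j, j))
  rw [lossGap, abs_le]
  constructor <;> linarith [h1.1, h1.2, h2.1, h2.2]

theorem weightedError_mem_Icc (η σ : Fin T → ℝ)
    {est : (j : Fin N) → (t : Fin T) → SuperSample N 𝒵 × ({i : Fin N // i ≠ j} → Fin 2) ×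
      (Fin T → Finset (Fin N)) × (Fin (t.val + 1) → Param d) → ℝ}
    (hest : ∀ j t x, est j t x ∈ Set.Icc (0 : ℝ) 1) (j : Fin N) (t : Fin T)
    (s : SuperSample N 𝒵) (u : Fin N → Fin 2) (v : Fin T → Finset (Fin N))
    (x : Param d × (Fin T → Param d)) :
    weightedError ℓ hyp η σ est j t s u v x ∈ Set.Icc 0 ((η t) ^ 2 / (σ t) ^ 2) := by
  obtain ⟨h0, h1⟩ := hest j t (s, bitsExcept u j, v, trajectory ℓ hyp η σ s u v x t.val)
  rw [weightedError]
  refine ⟨by positivity, mul_le_of_le_one_right (by positivity) ?_⟩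
  have hc : ((u j).val : ℝ) = 0 ∨ ((u j).val : ℝ) = 1 := by
    generalize u j = c
    fin_cases c <;> simp
  rcases hc with hc | hc <;> rw [hc] <;> nlinarith

theorem abs_rootError_le (η σ : Fin T → ℝ)
    {est : (j : Fin N) → (t : Fin T) → SuperSample N 𝒵 × ({i : Fin N // i ≠ j} → Fin 2) ×
      (Fin T → Finset (Fin N)) × (Fin (t.val + 1) → Param d) → ℝ}
    (hest : ∀ j t x, est j t x ∈ Set.Icc (0 : ℝ) 1)
    (ν : Measure (Param d × (Fin T → Param d))) [IsProbabilityMeasure ν] (j : Fin N)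
    (s : SuperSample N 𝒵) (u : Fin N → Fin 2) (v : Fin T → Finset (Fin N)) :
    |rootError ℓ hyp η σ est ν j s u v| ≤ Real.sqrt (∑ t, (η t) ^ 2 / (σ t) ^ 2) := by
  rw [rootError, abs_of_nonneg (Real.sqrt_nonneg _)]
  refine Real.sqrt_le_sqrt ((Finset.sum_le_sum fun t _ => ?_).trans
    (Finset.sum_le_univ_sum_of_nonneg fun t => by positivity))
  refine (le_abs_self _).trans (abs_integral_le_of_abs_le fun x => ?_)
  have h := weightedError_mem_Icc (ℓ := ℓ) (hyp := hyp) η σ hest j t s u v x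
  rw [abs_of_nonneg h.1]
  exact h.2

variable [MeasurableSpace 𝒵]

theorem measurable_dataset (u : Fin N → Fin 2) :
    Measurable fun s : SuperSample N 𝒵 => dataset s u :=
  measurable_pi_lambda _ fun i => measurable_pi_apply (u i, i)

theorem measurable_trajectory (hm : Measurable fun p : Param d × 𝒵 => ℓ (hyp p.1) p.2)
    (hd : ∀ z, Differentiable ℝ fun x : Param d => ℓ (hyp x) z) (η σ : Fin T → ℝ)
    {α : Type*} [MeasurableSpace α] {s : α → SuperSample N 𝒵} (hs : Measurable s)
    {u : α → Fin N → Fin 2} (hu : Measurable u) {v : α → Fin T → Finset (Fin N)}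
    (hv : Measurable v) {x : α → Param d × (Fin T → Param d)} (hx : Measurable x) (n : ℕ) :
    Measurable fun y => trajectory ℓ hyp η σ (s y) (u y) (v y) (x y) n := by
  have h (c : (Fin N → Fin 2) × (Fin T → Finset (Fin N))) :
      Measurable fun y => trajectory ℓ hyp η σ (s y) c.1 c.2 (x y) n :=
    measurable_history_sgldUpdate hm hd η σ ((measurable_dataset c.1).comp hs) c.2
      (measurable_fst.comp hx) (measurable_snd.comp hx) n
  have h' := Measurable.comp_countable h (hu.prodMk hv)
  exact h'

theorem measurable_lossGap (hm : Measurable fun p : Param d × 𝒵 => ℓ (hyp p.1) p.2)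
    (hd : ∀ z, Differentiable ℝ fun x : Param d => ℓ (hyp x) z) (η σ : Fin T → ℝ) (j : Fin N)
    {α : Type*} [MeasurableSpace α] {s : α → SuperSample N 𝒵} (hs : Measurable s)
    {u : α → Fin N → Fin 2} (hu : Measurable u) {v : α → Fin T → Finset (Fin N)}
    (hv : Measurable v) {x : α → Param d × (Fin T → Param d)} (hx : Measurable x) :
    Measurable fun y => lossGap ℓ hyp η σ j (s y) (u y) (v y) (x y) := by
  have hW : Measurable fun y => trajectory ℓ hyp η σ (s y) (u y) (v y) (x y) T (Fin.last T) :=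
    (measurable_pi_apply _).comp (measurable_trajectory hm hd η σ hs hu hv hx T)
  have hpt (r : Fin 2 → Fin 2) : Measurable fun y => s y (r (u y j), j) :=
    Measurable.comp_countable (f := fun y (c : Fin N → Fin 2) => s y (r (c j), j))
      (fun c => (measurable_pi_apply _).comp hs) hu
  exact (hm.comp (hW.prodMk (hpt fun c => 1 - c))).sub (hm.comp (hW.prodMk (hpt fun c => c)))

theorem measurable_weightedError (hm : Measurable fun p : Param d × 𝒵 => ℓ (hyp p.1) p.2)
    (hd : ∀ z, Differentiable ℝ fun x : Param d => ℓ (hyp x) z) (η σ : Fin T → ℝ)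
    {est : (j : Fin N) → (t : Fin T) → SuperSample N 𝒵 × ({i : Fin N // i ≠ j} → Fin 2) ×
      (Fin T → Finset (Fin N)) × (Fin (t.val + 1) → Param d) → ℝ}
    (hest : ∀ j t, Measurable (est j t)) (j : Fin N) (t : Fin T) {α : Type*} [MeasurableSpace α]
    {s : α → SuperSample N 𝒵} (hs : Measurable s) (u : Fin N → Fin 2)
    (v : Fin T → Finset (Fin N)) {x : α → Param d × (Fin T → Param d)} (hx : Measurable x) :
    Measurable fun y => weightedError ℓ hyp η σ est j t (s y) u v (x y) := by
  have h : Measurable fun y =>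
      est j t (s y, bitsExcept u j, v, trajectory ℓ hyp η σ (s y) u v (x y) t.val) :=
    (hest j t).comp (hs.prodMk (measurable_const.prodMk (measurable_const.prodMk
      (measurable_trajectory hm hd η σ hs measurable_const measurable_const hx t.val))))
  exact ((measurable_const.sub h).pow_const 2).const_mul _

theorem measurable_rootError (hm : Measurable fun p : Param d × 𝒵 => ℓ (hyp p.1) p.2)
    (hd : ∀ z, Differentiable ℝ fun x : Param d => ℓ (hyp x) z) (η σ : Fin T → ℝ)
    {est : (j : Fin N) → (t : Fin T) → SuperSample N 𝒵 × ({i : Fin N // i ≠ j} → Fin 2) ×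
      (Fin T → Finset (Fin N)) × (Fin (t.val + 1) → Param d) → ℝ}
    (hest : ∀ j t, Measurable (est j t))
    (ν : Measure (Param d × (Fin T → Param d))) [IsProbabilityMeasure ν] {α : Type*}
    [MeasurableSpace α] {j : α → Fin N} (hj : Measurable j) {s : α → SuperSample N 𝒵}
    (hs : Measurable s) {u : α → Fin N → Fin 2} (hu : Measurable u)
    {v : α → Fin T → Finset (Fin N)} (hv : Measurable v) :
    Measurable fun y => rootError ℓ hyp η σ est ν (j y) (s y) (u y) (v y) := by
  have h (c : Fin N × (Fin N → Fin 2) × (Fin T → Finset (Fin N))) :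
      Measurable fun y => rootError ℓ hyp η σ est ν c.1 (s y) c.2.1 c.2.2 := by
    refine (Finset.measurable_sum _ fun t _ => ?_).sqrt
    have h : Measurable fun p : α × Param d × (Fin T → Param d) =>
        weightedError ℓ hyp η σ est c.1 t (s p.1) c.2.1 c.2.2 p.2 :=
      measurable_weightedError hm hd η σ hest c.1 t (hs.comp measurable_fst) c.2.1 c.2.2
        measurable_snd
    exact h.stronglyMeasurable.integral_prod_right'.measurable
  have h' := Measurable.comp_countable h (hj.prodMk (hu.prodMk hv))
  exact h'

/-- The two values of the bit at `j` together satisfy the bound. -/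
theorem rootError_sub_lossGap_nonneg (hm : Measurable fun p : Param d × 𝒵 => ℓ (hyp p.1) p.2)
    {a b : ℝ} (hb : ∀ w z, ℓ w z ∈ Set.Icc a b)
    (hd : ∀ z, Differentiable ℝ fun x : Param d => ℓ (hyp x) z) {L : NNReal}
    (hL : ∀ z, LipschitzWith L fun x : Param d => ℓ (hyp x) z) (η : Fin T → ℝ) {σ : Fin T → ℝ}
    (hσ : ∀ t, 0 < σ t)
    {est : (j : Fin N) → (t : Fin T) → SuperSample N 𝒵 × ({i : Fin N // i ≠ j} → Fin 2) ×
      (Fin T → Finset (Fin N)) × (Fin (t.val + 1) → Param d) → ℝ}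
    (hest_meas : ∀ j t, Measurable (est j t))
    (hest : ∀ j t x, est j t x ∈ Set.Icc (0 : ℝ) 1)
    (ν₀ : Measure (Param d)) [IsProbabilityMeasure ν₀] (j : Fin N) (s : SuperSample N 𝒵)
    (u : Fin N → Fin 2) {v : Fin T → Finset (Fin N)} {K : ℕ} (hv : ∀ t, (v t).card = K) :
    ∫ x, lossGap ℓ hyp η σ j s (Function.update u j 0) v x
        ∂(ν₀.prod (Measure.pi fun _ => stdGaussian (Param d))) +
      ∫ x, lossGap ℓ hyp η σ j s (Function.update u j 1) v x
        ∂(ν₀.prod (Measure.pi fun _ => stdGaussian (Param d))) ≤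
    2 * (L : ℝ) / K * (b - a) *
        rootError ℓ hyp η σ est (ν₀.prod (Measure.pi fun _ => stdGaussian (Param d))) j s
          (Function.update u j 0) v +
      2 * (L : ℝ) / K * (b - a) *
        rootError ℓ hyp η σ est (ν₀.prod (Measure.pi fun _ => stdGaussian (Param d))) j s
          (Function.update u j 1) v := by
  let z : Fin 2 → Fin N → 𝒵 := fun c => dataset s (Function.update u j c)
  have hz : ∀ i, i ≠ j → z 0 i = z 1 i := fun i hi => by
    simp [z, dataset, Function.update_of_ne hi]
  let π : (t : Fin T) → (Fin (t.val + 1) → Param d) → ℝ := fun t h =>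
    est j t (s, bitsExcept u j, v, h)
  have hπ (t) : Measurable (π t) := (hest_meas j t).comp (measurable_const.prodMk
    (measurable_const.prodMk (measurable_const.prodMk measurable_id)))
  have hbits (c : Fin 2) : bitsExcept (Function.update u j c) j = bitsExcept u j := by
    funext i
    exact Function.update_of_ne i.2 _ _
  let f : Param d → ℝ := fun x => ℓ (hyp x) (s (1, j)) - ℓ (hyp x) (s (0, j))
  have hf : Measurable f := (hm.comp (measurable_id.prodMk measurable_const)).sub
    (hm.comp (measurable_id.prodMk measurable_const))
  have hfb (x) : |f x| ≤ b - a := by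
    have h1 := hb (hyp x) (s (1, j))
    have h2 := hb (hyp x) (s (0, j))
    simp only [f, abs_le]
    constructor <;> linarith [h1.1, h1.2, h2.1, h2.2]
  have h0 := integral_history_sub_le hm hd hL η hσ hz hv hπ (fun t h => hest j t _) ν₀ hf hfb 0
  -- With `-f` the reference mean enters with the opposite sign, so it cancels against the one in
  -- `h0`.
  have h1 := integral_history_sub_le hm hd hL η hσ hz hv hπ (fun t h => hest j t _) ν₀ hf.neg
    (fun x => by rw [Pi.neg_apply, abs_neg]; exact hfb x) 1
  simp only [Pi.neg_apply, integral_neg] at h1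
  have hg0 (x) : lossGap ℓ hyp η σ j s (Function.update u j 0) v x =
      f (history (sgldUpdate ℓ hyp η σ (z 0) v) x.1 x.2 T (Fin.last T)) := by
    simp [lossGap, f, z, trajectory]
  have hg1 (x) : lossGap ℓ hyp η σ j s (Function.update u j 1) v x =
      - f (history (sgldUpdate ℓ hyp η σ (z 1) v) x.1 x.2 T (Fin.last T)) := by
    simp [lossGap, f, z, trajectory]
  have hroot (c : Fin 2) :
      rootError ℓ hyp η σ est (ν₀.prod (Measure.pi fun _ => stdGaussian (Param d))) j s
        (Function.update u j c) v =
      Real.sqrt (∑ t ∈ itersWith v j, ∫ p, (η t) ^ 2 / (σ t) ^ 2 *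
        ((c.val : ℝ) - π t (history (sgldUpdate ℓ hyp η σ (z c) v) p.1 p.2 t.val)) ^ 2
        ∂(ν₀.prod (Measure.pi fun _ => stdGaussian (Param d)))) := by
    simp only [rootError, weightedError, Function.update_self, hbits]
    rfl
  simp only [hg0, hg1, integral_neg]
  rw [hroot 0, hroot 1]
  linarith

end Trajectory

/-! ### Averaging over the randomness, and the generalization error as a mean gap -/

section Risk

variable {𝒲 𝒵 : Type*} {N d T : ℕ} {ℓ : 𝒲 → 𝒵 → ℝ} {hyp : Param d → 𝒲} [MeasurableSpace 𝒵]

/-- The joint law of the super-sample, the bits, the batches, the initialization and the noise. -/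
def runLaw (PZ : Measure 𝒵) (N : ℕ) {d T : ℕ} (ρ : Measure (Fin T → Finset (Fin N)))
    (ν : Measure (Param d × (Fin T → Param d))) :
    Measure (SuperSample N 𝒵 × (Fin N → Fin 2) × (Fin T → Finset (Fin N)) ×
      (Param d × (Fin T → Param d))) :=
  (Measure.pi fun _ : Fin 2 × Fin N => PZ).prod
    ((Measure.pi fun _ : Fin N => (PMF.uniformOfFintype (Fin 2)).toMeasure).prod (ρ.prod ν))

instance isProbabilityMeasure_runLaw (PZ : Measure 𝒵) [IsProbabilityMeasure PZ]
    (ρ : Measure (Fin T → Finset (Fin N))) [IsProbabilityMeasure ρ]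
    (ν : Measure (Param d × (Fin T → Param d))) [IsProbabilityMeasure ν] :
    IsProbabilityMeasure (runLaw PZ N ρ ν) := by
  unfold runLaw
  infer_instance

/-- The pairwise bound controls only the sum over both values of the bit at `j`. The difference of
the two sides is therefore integrated as a whole, averaging over that bit before asking for
nonnegativity. -/
theorem integral_lossGap_le (hm : Measurable fun p : Param d × 𝒵 => ℓ (hyp p.1) p.2)
    {a b : ℝ} (hb : ∀ w z, ℓ w z ∈ Set.Icc a b)
    (hd : ∀ z, Differentiable ℝ fun x : Param d => ℓ (hyp x) z) {L : NNReal}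
    (hL : ∀ z, LipschitzWith L fun x : Param d => ℓ (hyp x) z) (η : Fin T → ℝ) {σ : Fin T → ℝ}
    (hσ : ∀ t, 0 < σ t)
    {est : (j : Fin N) → (t : Fin T) → SuperSample N 𝒵 × ({i : Fin N // i ≠ j} → Fin 2) ×
      (Fin T → Finset (Fin N)) × (Fin (t.val + 1) → Param d) → ℝ}
    (hest_meas : ∀ j t, Measurable (est j t))
    (hest : ∀ j t x, est j t x ∈ Set.Icc (0 : ℝ) 1)
    (PZ : Measure 𝒵) [IsProbabilityMeasure PZ]
    (ρ : Measure (Fin T → Finset (Fin N))) [IsProbabilityMeasure ρ]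
    (ν₀ : Measure (Param d)) [IsProbabilityMeasure ν₀] (j : Fin N)
    {K : ℕ} (hρ : ∀ᵐ v ∂ρ, ∀ t, (v t).card = K) :
    ∫ y, lossGap ℓ hyp η σ j y.1 y.2.1 y.2.2.1 y.2.2.2
        ∂(runLaw PZ N ρ (ν₀.prod (Measure.pi fun _ => stdGaussian (Param d)))) ≤
      2 * (L : ℝ) / K * (b - a) * ∫ y, rootError ℓ hyp η σ est
          (ν₀.prod (Measure.pi fun _ => stdGaussian (Param d))) j y.1 y.2.1 y.2.2.1
        ∂(runLaw PZ N ρ (ν₀.prod (Measure.pi fun _ => stdGaussian (Param d)))) := by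
  set ν := ν₀.prod (Measure.pi fun _ : Fin T => stdGaussian (Param d)) with hν
  set c := 2 * (L : ℝ) / K * (b - a)
  have hgap : Measurable fun y : SuperSample N 𝒵 × (Fin N → Fin 2) × (Fin T → Finset (Fin N)) ×
      (Param d × (Fin T → Param d)) => lossGap ℓ hyp η σ j y.1 y.2.1 y.2.2.1 y.2.2.2 :=
    measurable_lossGap hm hd η σ j measurable_fst measurable_snd.fst measurable_snd.snd.fst
      measurable_snd.snd.snd
  have hroot : Measurable fun y : SuperSample N 𝒵 × (Fin N → Fin 2) × (Fin T → Finset (Fin N)) ×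
      (Param d × (Fin T → Param d)) => rootError ℓ hyp η σ est ν j y.1 y.2.1 y.2.2.1 :=
    measurable_rootError hm hd η σ hest_meas ν measurable_const measurable_fst measurable_snd.fst
      measurable_snd.snd.fst
  let F : SuperSample N 𝒵 × (Fin N → Fin 2) × (Fin T → Finset (Fin N)) ×
      (Param d × (Fin T → Param d)) → ℝ := fun y =>
    c * rootError ℓ hyp η σ est ν j y.1 y.2.1 y.2.2.1 -
      lossGap ℓ hyp η σ j y.1 y.2.1 y.2.2.1 y.2.2.2
  have hF : Measurable F := (hroot.const_mul c).sub hgap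
  set C := |c| * Real.sqrt (∑ t, (η t) ^ 2 / (σ t) ^ 2) + (b - a)
  have hFb (y) : |F y| ≤ C := by
    refine (abs_sub _ _).trans (add_le_add ?_ (abs_lossGap_le hb η σ j _ _ _ _))
    rw [abs_mul]
    exact mul_le_mul_of_nonneg_left (abs_rootError_le η σ hest ν j _ _ _) (abs_nonneg c)
  have hgapi : Integrable (fun y => lossGap ℓ hyp η σ j y.1 y.2.1 y.2.2.1 y.2.2.2)
      (runLaw PZ N ρ ν) := integrable_of_abs_le hgap fun y => abs_lossGap_le hb η σ j _ _ _ _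
  have hrooti : Integrable (fun y => rootError ℓ hyp η σ est ν j y.1 y.2.1 y.2.2.1)
      (runLaw PZ N ρ ν) := integrable_of_abs_le hroot fun y => abs_rootError_le η σ hest ν j _ _ _
  have key : 0 ≤ ∫ y, F y ∂(runLaw PZ N ρ ν) := by
    rw [runLaw, integral_prod _ (integrable_of_abs_le hF hFb)]
    refine integral_nonneg fun s => ?_
    have hFs : Measurable fun q => F (s, q) := hF.comp measurable_prodMk_left
    change 0 ≤ ∫ q, F (s, q) ∂_
    rw [integral_prod _ (integrable_of_abs_le hFs fun q => hFb _)]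
    refine integral_bits_nonneg j fun u => ?_
    have hFu (u : Fin N → Fin 2) : Measurable fun q => F (s, u, q) :=
      hFs.comp measurable_prodMk_left
    have hFui (u : Fin N → Fin 2) : Integrable (fun q => F (s, u, q)) (ρ.prod ν) :=
      integrable_of_abs_le (hFu u) fun q => hFb _
    rw [integral_prod _ (hFui _), integral_prod _ (hFui _),
      ← integral_add (hFui _).integral_prod_left (hFui _).integral_prod_left]
    -- The batches have size `K` only almost surely, so nonnegativity holds for almost every `v`.
    refine integral_nonneg_of_ae (hρ.mono fun v hv => ?_)
    have hsplit (u : Fin N → Fin 2) : ∫ x, F (s, u, v, x) ∂ν =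
        c * rootError ℓ hyp η σ est ν j s u v - ∫ x, lossGap ℓ hyp η σ j s u v x ∂ν := by
      have hx : Measurable fun x => lossGap ℓ hyp η σ j s u v x :=
        measurable_lossGap hm hd η σ j measurable_const measurable_const measurable_const
          measurable_id
      have hxi : Integrable (fun x => lossGap ℓ hyp η σ j s u v x) ν :=
        integrable_of_abs_le hx fun x => abs_lossGap_le hb η σ j _ _ _ _
      simp only [F]
      rw [integral_sub (integrable_const _) hxi]
      simp
    have hpair := rootError_sub_lossGap_nonneg hm hb hd hL η hσ hest_meas hest ν₀ j s u hv
    rw [← hν] at hpair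
    simp only [Pi.zero_apply, hsplit]
    linarith
  have hFint : ∫ y, F y ∂(runLaw PZ N ρ ν) =
      c * ∫ y, rootError ℓ hyp η σ est ν j y.1 y.2.1 y.2.2.1 ∂(runLaw PZ N ρ ν) -
        ∫ y, lossGap ℓ hyp η σ j y.1 y.2.1 y.2.2.1 y.2.2.2 ∂(runLaw PZ N ρ ν) := by
    simp only [F]
    rw [integral_sub (hrooti.const_mul c) hgapi, integral_const_mul]
  linarith

theorem measurable_populationRisk (hm : Measurable fun p : Param d × 𝒵 => ℓ (hyp p.1) p.2)
    (PZ : Measure 𝒵) [IsProbabilityMeasure PZ] :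
    Measurable fun x => populationRisk ℓ PZ (hyp x) :=
  hm.stronglyMeasurable.integral_prod_right'.measurable

theorem measurable_trained (hm : Measurable fun p : Param d × 𝒵 => ℓ (hyp p.1) p.2)
    (hd : ∀ z, Differentiable ℝ fun x : Param d => ℓ (hyp x) z) (η σ : Fin T → ℝ) :
    Measurable fun y : SuperSample N 𝒵 × (Fin N → Fin 2) × (Fin T → Finset (Fin N)) ×
      (Param d × (Fin T → Param d)) =>
      trajectory ℓ hyp η σ y.1 y.2.1 y.2.2.1 y.2.2.2 T (Fin.last T) :=
  (measurable_pi_apply _).comp (measurable_trajectory hm hd η σ measurable_fst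
    measurable_snd.fst measurable_snd.snd.fst measurable_snd.snd.snd T)

theorem measurable_loss_trained (hm : Measurable fun p : Param d × 𝒵 => ℓ (hyp p.1) p.2)
    (hd : ∀ z, Differentiable ℝ fun x : Param d => ℓ (hyp x) z) (η σ : Fin T → ℝ)
    (r : Fin 2 → Fin 2) (j : Fin N) :
    Measurable fun y : SuperSample N 𝒵 × (Fin N → Fin 2) × (Fin T → Finset (Fin N)) ×
      (Param d × (Fin T → Param d)) =>
      ℓ (hyp (trajectory ℓ hyp η σ y.1 y.2.1 y.2.2.1 y.2.2.2 T (Fin.last T)))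
        (y.1 (r (y.2.1 j), j)) := by
  have hpt := Measurable.comp_countable
    (fun c : Fin N → Fin 2 => (measurable_pi_apply (r (c j), j)).comp
      (measurable_fst : Measurable fun y : SuperSample N 𝒵 × (Fin N → Fin 2) ×
        (Fin T → Finset (Fin N)) × (Param d × (Fin T → Param d)) => y.1)) measurable_snd.fst
  have h := hm.comp ((measurable_trained hm hd η σ).prodMk hpt)
  exact h

theorem measurable_risk_trained (hm : Measurable fun p : Param d × 𝒵 => ℓ (hyp p.1) p.2)
    (hd : ∀ z, Differentiable ℝ fun x : Param d => ℓ (hyp x) z) (η σ : Fin T → ℝ)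
    (PZ : Measure 𝒵) [IsProbabilityMeasure PZ] :
    Measurable fun y : SuperSample N 𝒵 × (Fin N → Fin 2) × (Fin T → Finset (Fin N)) ×
      (Param d × (Fin T → Param d)) => populationRisk ℓ PZ
        (hyp (trajectory ℓ hyp η σ y.1 y.2.1 y.2.2.1 y.2.2.2 T (Fin.last T))) := by
  have h := (measurable_populationRisk hm PZ).comp (measurable_trained (N := N) hm hd η σ)
  exact h

/-- The unselected point at `j` is a fresh sample for the trained hypothesis. -/
theorem integral_loss_unselected (hm : Measurable fun p : Param d × 𝒵 => ℓ (hyp p.1) p.2)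
    {M : ℝ} (hM : ∀ w z, |ℓ w z| ≤ M)
    (hd : ∀ z, Differentiable ℝ fun x : Param d => ℓ (hyp x) z) (η σ : Fin T → ℝ)
    (PZ : Measure 𝒵) [IsProbabilityMeasure PZ]
    (ρ : Measure (Fin T → Finset (Fin N))) [IsProbabilityMeasure ρ]
    (ν : Measure (Param d × (Fin T → Param d))) [IsProbabilityMeasure ν] (j : Fin N) :
    ∫ y, ℓ (hyp (trajectory ℓ hyp η σ y.1 y.2.1 y.2.2.1 y.2.2.2 T (Fin.last T)))
        (y.1 (1 - y.2.1 j, j)) ∂(runLaw PZ N ρ ν) =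
      ∫ y, populationRisk ℓ PZ
        (hyp (trajectory ℓ hyp η σ y.1 y.2.1 y.2.2.1 y.2.2.2 T (Fin.last T)))
        ∂(runLaw PZ N ρ ν) := by
  have hloss := measurable_loss_trained hm hd η σ (fun c => 1 - c) j
  have hrisk := measurable_risk_trained (N := N) hm hd η σ PZ
  unfold runLaw
  -- With the super-sample integrated innermost, the bits are frozen and the unselected position is
  -- a fixed coordinate. Resampling it leaves the dataset, hence the whole trajectory, unchanged.
  rw [integral_prod_symm _ (integrable_of_abs_le hloss fun y => hM _ _),
    integral_prod_symm _ (integrable_of_abs_le hrisk fun y => abs_integral_le_of_abs_le (hM _))]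
  refine integral_congr_ae (Filter.Eventually.of_forall fun r => ?_)
  have hr : Measurable fun s : SuperSample N 𝒵 =>
      ℓ (hyp (trajectory ℓ hyp η σ s r.1 r.2.1 r.2.2 T (Fin.last T))) (s (1 - r.1 j, j)) := by
    have h := hloss.comp (measurable_prodMk_right (y := r))
    exact h
  change ∫ s : SuperSample N 𝒵, ℓ (hyp (trajectory ℓ hyp η σ s r.1 r.2.1 r.2.2 T (Fin.last T)))
    (s (1 - r.1 j, j)) ∂_ = ∫ s : SuperSample N 𝒵, populationRisk ℓ PZ
      (hyp (trajectory ℓ hyp η σ s r.1 r.2.1 r.2.2 T (Fin.last T))) ∂_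
  rw [integral_pi_update hr (fun s => hM _ _) (1 - r.1 j, j)]
  refine integral_congr_ae (Filter.Eventually.of_forall fun s => ?_)
  refine integral_congr_ae (Filter.Eventually.of_forall fun z => ?_)
  have hdata : dataset (Function.update s (1 - r.1 j, j) z) r.1 = dataset s r.1 := by
    funext i
    refine Function.update_of_ne (fun h => ?_) _ _
    obtain ⟨h1, rfl⟩ := Prod.mk.inj h
    revert h1
    generalize r.1 i = c
    fin_cases c <;> simp
  simp only [trajectory, hdata, Function.update_self]

/-- In every gap the unselected loss has the mean of the population risk, the same for all `j`;
averaging the selected losses restores the empirical risk. -/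
theorem integral_genError_eq [NeZero N]
    (hm : Measurable fun p : Param d × 𝒵 => ℓ (hyp p.1) p.2)
    {M : ℝ} (hM : ∀ w z, |ℓ w z| ≤ M)
    (hd : ∀ z, Differentiable ℝ fun x : Param d => ℓ (hyp x) z) (η σ : Fin T → ℝ)
    (PZ : Measure 𝒵) [IsProbabilityMeasure PZ]
    (ρ : Measure (Fin T → Finset (Fin N))) [IsProbabilityMeasure ρ]
    (ν : Measure (Param d × (Fin T → Param d))) [IsProbabilityMeasure ν] :
    ∫ y, genError ℓ PZ (hyp (trajectory ℓ hyp η σ y.1 y.2.1 y.2.2.1 y.2.2.2 T (Fin.last T)))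
        (dataset y.1 y.2.1) ∂(runLaw PZ N ρ ν) =
      (1 / (N : ℝ)) * ∑ j, ∫ y, lossGap ℓ hyp η σ j y.1 y.2.1 y.2.2.1 y.2.2.2
        ∂(runLaw PZ N ρ ν) := by
  let W : SuperSample N 𝒵 × (Fin N → Fin 2) × (Fin T → Finset (Fin N)) ×
      (Param d × (Fin T → Param d)) → Param d := fun y =>
    trajectory ℓ hyp η σ y.1 y.2.1 y.2.2.1 y.2.2.2 T (Fin.last T)
  have hloss (r : Fin 2 → Fin 2) (j : Fin N) :
      Integrable (fun y => ℓ (hyp (W y)) (y.1 (r (y.2.1 j), j))) (runLaw PZ N ρ ν) :=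
    integrable_of_abs_le (measurable_loss_trained hm hd η σ r j) fun y => hM _ _
  have hrisk : Integrable (fun y => populationRisk ℓ PZ (hyp (W y))) (runLaw PZ N ρ ν) :=
    integrable_of_abs_le (measurable_risk_trained hm hd η σ PZ)
      fun y => abs_integral_le_of_abs_le (hM _)
  have hgap (j : Fin N) : ∫ y, lossGap ℓ hyp η σ j y.1 y.2.1 y.2.2.1 y.2.2.2 ∂(runLaw PZ N ρ ν) =
      ∫ y, populationRisk ℓ PZ (hyp (W y)) ∂(runLaw PZ N ρ ν) -
        ∫ y, ℓ (hyp (W y)) (y.1 (y.2.1 j, j)) ∂(runLaw PZ N ρ ν) := by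
    rw [← integral_loss_unselected hm hM hd η σ PZ ρ ν j]
    exact integral_sub (hloss (fun c => 1 - c) j) (hloss (fun c => c) j)
  have hgen : ∫ y, genError ℓ PZ (hyp (W y)) (dataset y.1 y.2.1) ∂(runLaw PZ N ρ ν) =
      ∫ y, populationRisk ℓ PZ (hyp (W y)) ∂(runLaw PZ N ρ ν) - (1 / (N : ℝ)) *
        ∑ j, ∫ y, ℓ (hyp (W y)) (y.1 (y.2.1 j, j)) ∂(runLaw PZ N ρ ν) := by
    rw [← integral_finsetSum _ fun j _ => hloss (fun c => c) j, ← integral_const_mul,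
      ← integral_sub hrisk ((integrable_finsetSum _ fun j _ => hloss (fun c => c) j).const_mul _)]
    simp only [genError, empiricalRisk, dataset, Finset.card_univ, Fintype.card_fin]
  have hN : (N : ℝ) ≠ 0 := Nat.cast_ne_zero.2 (NeZero.ne N)
  refine hgen.trans ?_
  simp only [hgap, Finset.sum_sub_distrib, Finset.sum_const, Finset.card_univ, Fintype.card_fin,
    nsmul_eq_mul]
  field_simp

end Risk

/-! ### Independence of the noise and the conditional law of the trajectory -/

theorem measurePreserving_assoc_right {A B Q R : Type*} [MeasurableSpace A] [MeasurableSpace B]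
    [MeasurableSpace Q] [MeasurableSpace R] (α : Measure A) (β : Measure B) {κ : Measure Q}
    {ν : Measure R} [IsProbabilityMeasure α] [IsProbabilityMeasure β] [IsProbabilityMeasure κ]
    [IsProbabilityMeasure ν] {f : Q → B × R} (hf : MeasurePreserving f κ (β.prod ν)) :
    MeasurePreserving (fun p : A × Q => ((p.1, (f p.2).1), (f p.2).2)) (α.prod κ)
      ((α.prod β).prod ν) :=
  (measurePreserving_prodAssoc α β ν).symm.comp ((MeasurePreserving.id α).prod hf)

theorem map_run_eq {Ω 𝒵 : Type*} [MeasurableSpace Ω] [MeasurableSpace 𝒵] {μ : Measure Ω}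
    {PZ : Measure 𝒵} [IsProbabilityMeasure PZ] {N d T : ℕ} [NeZero N]
    {ρ : Measure (Fin T → Finset (Fin N))} [IsProbabilityMeasure ρ]
    {ν : Measure (Param d × (Fin T → Param d))} [IsProbabilityMeasure ν]
    {J : Ω → Fin N} {S : Ω → SuperSample N 𝒵} {U : Ω → Fin N → Fin 2}
    {V : Ω → Fin T → Finset (Fin N)} {X : Ω → Param d × (Fin T → Param d)}
    (hJ : Measurable J) (hS : Measurable S) (hU : Measurable U) (hV : Measurable V)
    (hX : Measurable X)
    (hlaw : μ.map (fun ω => (J ω, S ω, U ω, V ω, X ω)) =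
      (PMF.uniformOfFintype (Fin N)).toMeasure.prod (runLaw PZ N ρ ν)) :
    μ.map (fun ω => ((J ω, S ω, U ω, V ω), X ω)) =
      ((PMF.uniformOfFintype (Fin N)).toMeasure.prod
        ((Measure.pi fun _ : Fin 2 × Fin N => PZ).prod
          ((Measure.pi fun _ : Fin N => (PMF.uniformOfFintype (Fin 2)).toMeasure).prod ρ))).prod
        ν := by
  have hmp := measurePreserving_assoc_right (PMF.uniformOfFintype (Fin N)).toMeasure
    ((Measure.pi fun _ : Fin 2 × Fin N => PZ).prod
      ((Measure.pi fun _ : Fin N => (PMF.uniformOfFintype (Fin 2)).toMeasure).prod ρ))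
    (measurePreserving_assoc_right (Measure.pi fun _ : Fin 2 × Fin N => PZ)
      ((Measure.pi fun _ : Fin N => (PMF.uniformOfFintype (Fin 2)).toMeasure).prod ρ)
      (measurePreserving_assoc_right
        (Measure.pi fun _ : Fin N => (PMF.uniformOfFintype (Fin 2)).toMeasure) ρ
        (MeasurePreserving.id (ρ.prod ν))))
  have h := hmp.map_eq
  change Measure.map _ ((PMF.uniformOfFintype (Fin N)).toMeasure.prod (runLaw PZ N ρ ν)) = _ at h
  rw [← hlaw, Measure.map_map hmp.measurable
    (hJ.prodMk (hS.prodMk (hU.prodMk (hV.prodMk hX))))] at h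
  exact h

/-- The trajectory law is almost surely the law of the recursion driven by fresh noise. -/
theorem trajectoryLaw_ae_eq {Ω 𝒲 𝒵 : Type*} [MeasurableSpace Ω] [MeasurableSpace 𝒵]
    {μ : Measure Ω} [IsProbabilityMeasure μ] {N d T : ℕ} {ℓ : 𝒲 → 𝒵 → ℝ} {hyp : Param d → 𝒲}
    (hm : Measurable fun p : Param d × 𝒵 => ℓ (hyp p.1) p.2)
    (hd : ∀ z, Differentiable ℝ fun x : Param d => ℓ (hyp x) z) (η σ : Fin T → ℝ)
    {S : Ω → SuperSample N 𝒵} {U : Ω → Fin N → Fin 2} {V : Ω → Fin T → Finset (Fin N)}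
    {θ : Fin (T + 1) → Ω → Param d} {X : Ω → Param d × (Fin T → Param d)}
    (hS : Measurable S) (hU : Measurable U) (hV : Measurable V) (hθ : ∀ t, Measurable (θ t))
    (hX : Measurable X) {ν : Measure (Param d × (Fin T → Param d))} [IsProbabilityMeasure ν]
    (t : Fin T)
    (hlaw : μ.map (fun ω => ((U ω, S ω, batchesBefore (V ω) t), X ω)) =
      (μ.map fun ω => (U ω, S ω, batchesBefore (V ω) t)).prod ν)
    (htraj : ∀ᵐ ω ∂μ, paramsUpTo (fun s => θ s ω) t =
      trajectory ℓ hyp η σ (S ω) (U ω) (V ω) (X ω) t.val) :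
    ∀ᵐ ω ∂μ, trajectoryLaw μ S U V θ t (U ω, S ω, batchesBefore (V ω) t) =
      ν.map fun x => trajectory ℓ hyp η σ (S ω) (U ω) (V ω) x t.val := by
  -- Later batches do not affect `θ 0, …, θ t`, so they may be replaced by `∅`; this makes the
  -- trajectory a function of the conditioning variables and the noise.
  let extend : (Fin t.val → Finset (Fin N)) → Fin T → Finset (Fin N) := fun v s =>
    if h : s.val < t.val then v ⟨s.val, h⟩ else ∅
  have hext (v : Fin T → Finset (Fin N)) (s : SuperSample N 𝒵) (u : Fin N → Fin 2)
      (x : Param d × (Fin T → Param d)) :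
      trajectory ℓ hyp η σ s u v x t.val =
        trajectory ℓ hyp η σ s u (extend (batchesBefore v t)) x t.val := by
    refine history_congr fun r hr => ?_
    have : extend (batchesBefore v t) r = v r := dif_pos hr
    simp only [sgldUpdate, this]
  have hbb : Measurable fun ω => batchesBefore (V ω) t :=
    measurable_pi_lambda _ fun s => (measurable_pi_apply _).comp hV
  have hpar : Measurable fun ω => paramsUpTo (fun s => θ s ω) t :=
    measurable_pi_lambda _ fun s => hθ _
  let F : (Fin N → Fin 2) × SuperSample N 𝒵 × (Fin t.val → Finset (Fin N)) →
      Param d × (Fin T → Param d) → Fin (t.val + 1) → Param d := fun c x =>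
    trajectory ℓ hyp η σ c.2.1 c.1 (extend c.2.2) x t.val
  have hF : Measurable fun p : ((Fin N → Fin 2) × SuperSample N 𝒵 ×
      (Fin t.val → Finset (Fin N))) × Param d × (Fin T → Param d) => F p.1 p.2 :=
    measurable_trajectory hm hd η σ measurable_fst.snd.fst measurable_fst.fst
      ((measurable_of_countable extend).comp measurable_fst.snd.snd) measurable_snd t.val
  have h := condDistrib_ae_eq_map (hU.prodMk (hS.prodMk hbb)) hX hpar hF hlaw
    (htraj.mono fun ω hω => hω.trans (hext _ _ _ _))
  filter_upwards [h] with ω hω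
  refine hω.trans ?_
  congr 1
  funext x
  exact (hext _ _ _ _).symm

end

/-! ### Transfer to the given probability space -/

theorem corollary1
    {Ω 𝒲 𝒵 : Type*} [MeasurableSpace Ω] [MeasurableSpace 𝒵]
    (μ : Measure Ω) [IsProbabilityMeasure μ]
    (PZ : Measure 𝒵) [IsProbabilityMeasure PZ]
    {N d T : ℕ} [NeZero N]
    -- the loss, bounded in `[a, b]`, and the hypotheses parametrized by `ℝ^d`
    (ℓ : 𝒲 → 𝒵 → ℝ) (hyp : Param d → 𝒲)
    (hℓ_meas : Measurable fun p : Param d × 𝒵 => ℓ (hyp p.1) p.2)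
    (a b : ℝ) (hℓ_bdd : ∀ w z, ℓ w z ∈ Set.Icc a b)
    (hℓ_diff : ∀ z, Differentiable ℝ fun x : Param d => ℓ (hyp x) z)
    (L : NNReal) (hℓ_lip : ∀ z, LipschitzWith L fun x : Param d => ℓ (hyp x) z)
    -- learning rates and noise levels
    (η σ : Fin T → ℝ) (hσ : ∀ t, 0 < σ t)
    -- random index, super-sample, Bernoulli bits, batches, parameters, Gaussian noise
    (J : Ω → Fin N) (S : Ω → SuperSample N 𝒵) (U : Ω → Fin N → Fin 2)
    (V : Ω → Fin T → Finset (Fin N)) (θ : Fin (T + 1) → Ω → Param d) (ε : Ω → Fin T → Param d)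
    (hJ : Measurable J) (hS : Measurable S) (hU : Measurable U) (hV : Measurable V)
    (hθ : ∀ t, Measurable (θ t)) (hε : Measurable ε)
    -- these are mutually independent, with the laws of the randomized subsample setting;
    -- the laws of the batch trajectory and of the initialization are arbitrary
    (hlaw : μ.map (fun ω => (J ω, S ω, U ω, V ω, θ 0 ω, ε ω)) =
      (PMF.uniformOfFintype (Fin N)).toMeasure.prod
        ((Measure.pi fun _ : Fin 2 × Fin N => PZ).prod
          ((Measure.pi fun _ : Fin N => (PMF.uniformOfFintype (Fin 2)).toMeasure).prod
            ((μ.map V).prod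
              ((μ.map (θ 0)).prod
                (Measure.pi fun _ : Fin T => stdGaussian (Param d)))))))
    -- the batches have constant size `K`
    (K : ℕ) (hK : 0 < K) (hcard : ∀ t, ∀ᵐ ω ∂μ, (V ω t).card = K)
    -- the iterations of the algorithm on the selected dataset
    (hstep : ∀ t : Fin T, ∀ᵐ ω ∂μ, θ t.succ ω =
      sgldStep ℓ hyp (dataset (S ω) (U ω)) (V ω t) (η t) (σ t) (θ t.castSucc ω) (ε ω t))
    -- any estimate in `[0, 1]` of the event `U_J = 1`, computed from the super-sample, the bits
    -- other than `U_J`, the batches and the past trajectory of the parameters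
    (est : (j : Fin N) → (t : Fin T) → SuperSample N 𝒵 × ({i : Fin N // i ≠ j} → Fin 2) ×
      (Fin T → Finset (Fin N)) × (Fin (t.val + 1) → Param d) → ℝ)
    (hest_meas : ∀ j t, Measurable (est j t))
    (hest : ∀ j t x, est j t x ∈ Set.Icc (0 : ℝ) 1) :
    ∫ ω, genError ℓ PZ (hyp (θ (Fin.last T) ω)) (dataset (S ω) (U ω)) ∂μ ≤
      2 * (L : ℝ) / (K : ℝ) * (b - a) *
        ∫ ω, Real.sqrt (∑ t ∈ itersWith (V ω) (J ω),
          ∫ h, (η t) ^ 2 / (σ t) ^ 2 *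
              (((U ω (J ω)).val : ℝ) -
                est (J ω) t (S ω, bitsExcept (U ω) (J ω), V ω, h)) ^ 2
            ∂(trajectoryLaw μ S U V θ t (U ω, S ω, batchesBefore (V ω) t))) ∂μ := by
  set ν₀ := μ.map (θ 0)
  set ρ := μ.map V with hρdef
  have : IsProbabilityMeasure ν₀ := Measure.isProbabilityMeasure_map (hθ 0).aemeasurable
  have : IsProbabilityMeasure ρ := Measure.isProbabilityMeasure_map hV.aemeasurable
  set ν := ν₀.prod (Measure.pi fun _ : Fin T => stdGaussian (Param d))
  let X : Ω → Param d × (Fin T → Param d) := fun ω => (θ 0 ω, ε ω)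
  have hX : Measurable X := (hθ 0).prodMk hε
  have hrun : Measurable fun ω => (J ω, S ω, U ω, V ω, X ω) :=
    hJ.prodMk (hS.prodMk (hU.prodMk (hV.prodMk hX)))
  have hlaw' : μ.map (fun ω => (J ω, S ω, U ω, V ω, X ω)) =
      (PMF.uniformOfFintype (Fin N)).toMeasure.prod (runLaw PZ N ρ ν) := hlaw
  have hρ : ∀ᵐ v ∂ρ, ∀ t, (v t).card = K := by
    rw [hρdef, ae_map_iff hV.aemeasurable (Set.to_countable _).measurableSet]
    exact ae_all_iff.2 hcard
  have hM (w z) : |ℓ w z| ≤ max |a| |b| :=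
    abs_le_max_abs_abs (hℓ_bdd w z).1 (hℓ_bdd w z).2
  have htraj : ∀ᵐ ω ∂μ, ∀ n (hn : n ≤ T),
      (fun s : Fin (n + 1) => θ ⟨s.val, lt_of_lt_of_le s.isLt (Nat.succ_le_succ hn)⟩ ω) =
        trajectory ℓ hyp η σ (S ω) (U ω) (V ω) (X ω) n := by
    filter_upwards [ae_all_iff.2 hstep] with ω hω n hn
    exact eq_history (p := fun s => θ s ω) rfl hω n hn
  have hlast : ∀ᵐ ω ∂μ, θ (Fin.last T) ω =
      trajectory ℓ hyp η σ (S ω) (U ω) (V ω) (X ω) T (Fin.last T) :=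
    htraj.mono fun ω hω => congrFun (hω T le_rfl) (Fin.last T)
  have hsplit := map_run_eq hJ hS hU hV hX hlaw'
  have hcond (t : Fin T) : ∀ᵐ ω ∂μ,
      trajectoryLaw μ S U V θ t (U ω, S ω, batchesBefore (V ω) t) =
        ν.map fun x => trajectory ℓ hyp η σ (S ω) (U ω) (V ω) x t.val := by
    refine trajectoryLaw_ae_eq hℓ_meas hℓ_diff η σ hS hU hV hθ hX t ?_
      (htraj.mono fun ω hω => hω t.val t.isLt.le)
    refine map_comp_prod_eq (g := fun q : Fin N × SuperSample N 𝒵 × (Fin N → Fin 2) ×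
      (Fin T → Finset (Fin N)) => (q.2.2.1, q.2.1, batchesBefore q.2.2.2 t))
      (hJ.prodMk (hS.prodMk (hU.prodMk hV))) hX hsplit ?_
    exact measurable_snd.snd.fst.prodMk (measurable_snd.fst.prodMk
      ((measurable_of_countable fun v : Fin T → Finset (Fin N) => batchesBefore v t).comp
        measurable_snd.snd.snd))
  have hroot : ∀ᵐ ω ∂μ, Real.sqrt (∑ t ∈ itersWith (V ω) (J ω),
      ∫ h, (η t) ^ 2 / (σ t) ^ 2 * (((U ω (J ω)).val : ℝ) -
          est (J ω) t (S ω, bitsExcept (U ω) (J ω), V ω, h)) ^ 2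
        ∂(trajectoryLaw μ S U V θ t (U ω, S ω, batchesBefore (V ω) t))) =
      rootError ℓ hyp η σ est ν (J ω) (S ω) (U ω) (V ω) := by
    filter_upwards [ae_all_iff.2 hcond] with ω hω
    rw [rootError]
    congr 1
    refine Finset.sum_congr rfl fun t _ => ?_
    have hest' : Measurable fun h => est (J ω) t (S ω, bitsExcept (U ω) (J ω), V ω, h) :=
      (hest_meas (J ω) t).comp (measurable_const.prodMk (measurable_const.prodMk
        (measurable_const.prodMk measurable_id)))
    have htm : Measurable fun x => trajectory ℓ hyp η σ (S ω) (U ω) (V ω) x t.val :=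
      measurable_trajectory hℓ_meas hℓ_diff η σ measurable_const measurable_const measurable_const
        measurable_id t.val
    have hint : Measurable fun h => (η t) ^ 2 / (σ t) ^ 2 * (((U ω (J ω)).val : ℝ) -
        est (J ω) t (S ω, bitsExcept (U ω) (J ω), V ω, h)) ^ 2 :=
      ((measurable_const.sub hest').pow_const 2).const_mul _
    rw [hω t, integral_map htm.aemeasurable hint.aestronglyMeasurable]
    rfl
  have hrootm : Measurable fun q : Fin N × SuperSample N 𝒵 × (Fin N → Fin 2) ×
      (Fin T → Finset (Fin N)) × (Param d × (Fin T → Param d)) =>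
      rootError ℓ hyp η σ est ν q.1 q.2.1 q.2.2.1 q.2.2.2.1 :=
    measurable_rootError hℓ_meas hℓ_diff η σ hest_meas ν measurable_fst measurable_snd.fst
      measurable_snd.snd.fst measurable_snd.snd.snd.fst
  have hright : ∫ ω, rootError ℓ hyp η σ est ν (J ω) (S ω) (U ω) (V ω) ∂μ =
      (1 / (N : ℝ)) * ∑ j, ∫ y, rootError ℓ hyp η σ est ν j y.1 y.2.1 y.2.2.1
        ∂(runLaw PZ N ρ ν) := by
    have h := integral_map (μ := μ) hrun.aemeasurable hrootm.aestronglyMeasurable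
    rw [hlaw', integral_prod _ (integrable_of_abs_le hrootm fun q =>
      abs_rootError_le η σ hest ν _ _ _ _), integral_uniformOfFintype, Fintype.card_fin] at h
    exact h.symm
  have hgenm : Measurable fun y : SuperSample N 𝒵 × (Fin N → Fin 2) ×
      (Fin T → Finset (Fin N)) × (Param d × (Fin T → Param d)) =>
      genError ℓ PZ (hyp (trajectory ℓ hyp η σ y.1 y.2.1 y.2.2.1 y.2.2.2 T (Fin.last T)))
        (dataset y.1 y.2.1) := by
    unfold genError empiricalRisk
    exact (measurable_risk_trained hℓ_meas hℓ_diff η σ PZ).sub ((Finset.measurable_sum _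
      fun i _ => measurable_loss_trained hℓ_meas hℓ_diff η σ (fun c => c) i).const_mul _)
  have hrunlaw : μ.map (fun ω => (S ω, U ω, V ω, X ω)) = runLaw PZ N ρ ν := by
    have h := congrArg (Measure.map Prod.snd) hlaw'
    rw [Measure.map_map measurable_snd hrun] at h
    simpa [Function.comp_def] using h
  have hleft : ∫ ω, genError ℓ PZ (hyp (θ (Fin.last T) ω)) (dataset (S ω) (U ω)) ∂μ =
      ∫ y, genError ℓ PZ (hyp (trajectory ℓ hyp η σ y.1 y.2.1 y.2.2.1 y.2.2.2 T (Fin.last T)))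
        (dataset y.1 y.2.1) ∂(runLaw PZ N ρ ν) := by
    rw [← hrunlaw, integral_map (hS.prodMk (hU.prodMk (hV.prodMk hX))).aemeasurable
      hgenm.aestronglyMeasurable]
    exact integral_congr_ae (hlast.mono fun ω hω => by simp only [hω])
  -- Both sides are now averages over `j` of integrals against the same run law, so the comparison
  -- is made term by term.
  rw [hleft, integral_congr_ae hroot, hright,
    integral_genError_eq hℓ_meas hM hℓ_diff η σ PZ ρ ν, mul_left_comm, Finset.mul_sum _ _
      (2 * (L : ℝ) / (K : ℝ) * (b - a))]
  refine mul_le_mul_of_nonneg_left (Finset.sum_le_sum fun j _ => ?_) (by positivity)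
  exact integral_lossGap_le hℓ_meas hℓ_bdd hℓ_diff hℓ_lip η hσ hest_meas hest PZ ρ ν₀ j hρ
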